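/- Consider the symmetric two-user complex Gaussian interference channel with feedback. At each time $i$ the outputs are $$Y_{1i} = g_d X_{1i} + g_c X_{2i} + Z_{1i}, \qquad Y_{2i} = g_c X_{1i} + g_d X_{2i} + Z_{2i},$$ where $g_d, g_c \in \mathbb{C}$ are fixed and the noises $Z_{ki}$ are i.i.d. $\mathcal{CN}(0,1)$ over $k$ and $i$. Put $\mathsf{SNR} = |g_d|^2$ and $\mathsf{INR} = |g_c|^2$. The messages $W_1, W_2$ are independent and uniform on finite sets of sizes $M_1, M_2$. Transmitter $k$ sends $X_{ki} = f_k^i(W_k, Y_{k1}, \dots, Y_{k(i-1)})$, and receiver $k$ estimates $W_k$ from $Y_{k1}, \dots, Y_{kn}$, where $n$ is the block length. For every pair of messages, the power constraint $\frac1n \sum_{i=1}^n \mathbb{E}|X_{ki}|^2 \le 1$ holds for $k = 1,2$, the expectation being over the noise. A pair $(R_1,R_2)$ of non-negative reals is achievable if there are such codes, one for every sufficiently large $n$, with $M_k \ge 2^{nR_k}$ and with the probability that some receiver errs tending to $0$ as $n \to \infty$. The capacity region is the closure of the set of achievable pairs, and a symmetric rate $R$ is said to be achieved if $(R,R)$ lies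 in the capacity region. All logarithms are to base 2. Then the following symmetric rates are achieved. If $\mathsf{INR} \ge \mathsf{SNR}$: $$R = \tfrac12 \log(1+\mathsf{INR}).$$ If $\mathsf{INR} \le \mathsf{SNR}$: $$R = \begin{cases} \log\left(1+\dfrac{\mathsf{SNR}}{2\,\mathsf{INR}}\right) + \dfrac12 \log(1+\mathsf{INR}) - \dfrac12, & \mathsf{INR} \ge 1,\\[2ex] \log\left(1+\dfrac{\mathsf{SNR}}{\mathsf{INR}+1}\right), & \mathsf{INR} \le 1.\end{cases}$$ -/

import Mathlib

open MeasureTheory ProbabilityTheory Filter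

namespace FeedbackIC

/-- The circularly symmetric complex Gaussian law `CN(0,1)`: independent real and imaginary parts,
each centred Gaussian with variance `1/2`, so that the mean of `|Z|^2` is `1`. -/
noncomputable def complexGaussian : Measure ℂ :=
  ((gaussianReal 0 (1 / 2)).prod (gaussianReal 0 (1 / 2))).map
    Complex.measurableEquivRealProd.symm

instance : IsProbabilityMeasure complexGaussian :=
  Measure.isProbabilityMeasure_map Complex.measurableEquivRealProd.symm.measurable.aemeasurable

/-- Law of the noise `z k i` over `n` channel uses: i.i.d. `CN(0,1)` over receivers and time. -/
noncomputable def noise (n : ℕ) : Measure (Fin 2 → Fin n → ℂ) :=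
  Measure.pi fun _ => Measure.pi fun _ => complexGaussian

instance (n : ℕ) : IsProbabilityMeasure (noise n) := by
  unfold noise; infer_instance

/-- A feedback code of block length `n` for two users (indexed by `Fin 2`) with message sets
`Fin (M 0)` and `Fin (M 1)`. At time `i`, transmitter `k` knows its own message and the outputs of
its own receiver at the times before `i`. -/
structure Code (n : ℕ) (M : Fin 2 → ℕ) where
  /-- encoding functions: time, own message, past outputs at the own receiver -/
  enc : (k : Fin 2) → (i : Fin n) → Fin (M k) → (Fin i.val → ℂ) → ℂ
  /-- decoding functions -/
  dec : (k : Fin 2) → (Fin n → ℂ) → Fin (M k)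
  measurable_enc : ∀ k i m, Measurable (enc k i m)
  measurable_dec : ∀ k, Measurable (dec k)

namespace Code

variable {n : ℕ} {M : Fin 2 → ℕ}

/-- The output of receiver `k` at time `i` over the symmetric interference channel with direct gain
`gd` and cross gain `gc`, when the messages are `w` and the noise is `z`. The user other than `k`
is `1 - k`. -/
noncomputable def output (C : Code n M) (gd gc : ℂ) (w : (k : Fin 2) → Fin (M k))
    (z : Fin 2 → Fin n → ℂ) (k : Fin 2) (i : Fin n) : ℂ :=
  gd * C.enc k i (w k) (fun j => output C gd gc w z k ⟨j, j.2.trans i.2⟩)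
    + gc * C.enc (1 - k) i (w (1 - k)) (fun j => output C gd gc w z (1 - k) ⟨j, j.2.trans i.2⟩)
    + z k i
termination_by i.val
decreasing_by
  · exact j.2
  · exact j.2

/-- The signal sent by transmitter `k` at time `i`. -/
noncomputable def input (C : Code n M) (gd gc : ℂ) (w : (k : Fin 2) → Fin (M k))
    (z : Fin 2 → Fin n → ℂ) (k : Fin 2) (i : Fin n) : ℂ :=
  C.enc k i (w k) (fun j => C.output gd gc w z k ⟨j, j.2.trans i.2⟩)

/-- The channel law `Y k = gd * X k + gc * X (1 - k) + Z k` at each time. -/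
theorem output_eq (C : Code n M) (gd gc : ℂ) (w : (k : Fin 2) → Fin (M k))
    (z : Fin 2 → Fin n → ℂ) (k : Fin 2) (i : Fin n) :
    C.output gd gc w z k i =
      gd * C.input gd gc w z k i + gc * C.input gd gc w z (1 - k) i + z k i := by
  rw [output]; rfl

/-- Unit average power for both users: for all messages, the power of the transmitted signal,
averaged over the block, has expectation at most `1` with respect to the noise. -/
def PowerConstraint (C : Code n M) (gd gc : ℂ) : Prop :=
  ∀ (w : (k : Fin 2) → Fin (M k)) (k : Fin 2),
    ∫⁻ z, ∑ i : Fin n, ‖C.input gd gc w z k i‖ₑ ^ 2 ∂(noise n) ≤ n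

/-- Probability that at least one receiver decodes its message wrongly, for independent and
uniformly distributed messages. -/
noncomputable def errorProb (C : Code n M) (gd gc : ℂ) : ℝ :=
  (∑ w : (k : Fin 2) → Fin (M k),
      (noise n).real {z | ∃ k, C.dec k (C.output gd gc w z k) ≠ w k})
    / ((M 0 : ℝ) * (M 1 : ℝ))

end Code

/-- The rate pair `R` (in bits per channel use) is achieved by feedback codes with vanishing
error probability. -/
def Achievable (gd gc : ℂ) (R : ℝ × ℝ) : Prop :=
  0 ≤ R.1 ∧ 0 ≤ R.2 ∧
    ∀ ε : ℝ, 0 < ε → ∀ᶠ n : ℕ in atTop, ∃ (M : Fin 2 → ℕ) (C : Code n M),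
      (2 : ℝ) ^ ((n : ℝ) * R.1) ≤ (M 0 : ℝ) ∧ (2 : ℝ) ^ ((n : ℝ) * R.2) ≤ (M 1 : ℝ) ∧
      C.PowerConstraint gd gc ∧ C.errorProb gd gc ≤ ε

/-- The capacity region of the channel with feedback: the closure of the achievable rate pairs. -/
def capacityRegion (gd gc : ℂ) : Set (ℝ × ℝ) :=
  closure {R | Achievable gd gc R}

end FeedbackIC

/-! Coding takes place over two blocks of length `N`. In the first, each user superposes a common
Gaussian codeword of power `α` and a private one of power `β`. From feedback each transmitter
subtracts its own signal and decodes the other user's common message, treating the other private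
codeword as noise. In the second block each user relays the other's common codeword, with the signs
and conjugations of the Alamouti code, and adds a fresh private codeword.

Over the two blocks the common codewords pass through an orthogonal 2×2 matrix, up to a scalar. Each
receiver can therefore combine its blocks so that one common codeword gets gain `SNR + INR` and the
other cancels. After decoding and removing both, it decodes its private codeword in each block,
treating the interfering private one as noise. The common rate is limited by the transmitters'
decoding (`commonRatio_le`). One common and two private messages over two blocks give `R = 1/2 log(1
+ INR α/(1 + INR β)) + log(1 + SNR β/(1 + INR β))` whenever `α + β ≤ 1` (`mem_capacityRegion`).
Three choices of `(α, β)` give the three rates.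

For the error analysis, all codewords of all books and all noise blocks form one family of i.i.d.
Gaussian blocks, and each decoding step sees a fixed linear combination of them. Chebyshev's
inequality controls the true codeword and a Chernoff bound the false ones
(`eventually_decodingFails_le`). Outside a small bad event all steps succeed deterministically
(`superpositionCode_correct`), and averaging over codebooks yields a good one (`exists_codebook`).
-/

namespace FeedbackIC

/-! ### Products of identical measures -/

/-- Distinct coordinates of an i.i.d. family are again i.i.d. This is what singles out, from all
codebooks, the few blocks relevant to one choice of messages. -/
theorem measurePreserving_precomp {α ι κ : Type*} [MeasurableSpace α] [Fintype ι] [Fintype κ]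
    (ν : Measure α) [IsProbabilityMeasure ν] {f : κ → ι} (hf : Function.Injective f) :
    MeasurePreserving (fun (ω : ι → α) k => ω (f k))
      (Measure.pi fun _ => ν) (Measure.pi fun _ => ν) := by
  refine ⟨by fun_prop, ?_⟩
  have h : iIndepFun (fun (i : ι) (ω : ι → α) => ω i) (Measure.pi fun _ => ν) :=
    iIndepFun_pi (X := fun _ => id) fun _ => aemeasurable_id
  have h2 := (h.precomp hf).map_fun_eq_pi_map (fun i => (measurable_pi_apply _).aemeasurable)
  rw [h2]
  congr 1
  ext1 k
  exact (measurePreserving_eval (fun _ => ν) (f k)).map_eq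

theorem measurePreserving_curry {α ι κ : Type*} [MeasurableSpace α] [Fintype ι] [Fintype κ]
    (ν : Measure α) [IsProbabilityMeasure ν] :
    MeasurePreserving (MeasurableEquiv.curry ι κ α)
      (Measure.pi fun _ => ν) (Measure.pi fun _ => Measure.pi fun _ => ν) := by
  refine ⟨(MeasurableEquiv.curry ι κ α).measurable, ?_⟩
  have := Measure.infinitePi_map_curry (fun (_ : ι) (_ : κ) => ν)
  simpa [Measure.infinitePi_eq_pi] using this

theorem measurePreserving_uncurry {α ι κ : Type*} [MeasurableSpace α] [Fintype ι] [Fintype κ]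
    (ν : Measure α) [IsProbabilityMeasure ν] :
    MeasurePreserving (MeasurableEquiv.curry ι κ α).symm
      (Measure.pi fun _ => Measure.pi fun _ => ν) (Measure.pi fun _ => ν) :=
  (measurePreserving_curry ν).symm _

theorem measurePreserving_swap_pi {α ι κ : Type*} [MeasurableSpace α] [Fintype ι] [Fintype κ]
    (ν : Measure α) [IsProbabilityMeasure ν] :
    MeasurePreserving (fun (ω : ι → κ → α) k i => ω i k)
      (Measure.pi fun _ => Measure.pi fun _ => ν) (Measure.pi fun _ => Measure.pi fun _ => ν) :=
  (measurePreserving_curry ν).comp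
    ((measurePreserving_precomp ν (f := fun p : κ × ι => (p.2, p.1))
      (fun p q h => by simpa [Prod.ext_iff, and_comm] using h)).comp (measurePreserving_uncurry ν))

/-! ### The complex Gaussian law -/

theorem measurePreserving_complexGaussian :
    MeasurePreserving Complex.measurableEquivRealProd.symm
      ((gaussianReal 0 (1 / 2)).prod (gaussianReal 0 (1 / 2))) complexGaussian :=
  ⟨Complex.measurableEquivRealProd.symm.measurable, rfl⟩

theorem measurePreserving_re : MeasurePreserving Complex.re complexGaussian
    (gaussianReal 0 (1 / 2)) := by
  have h := (measurePreserving_fst (μ := gaussianReal 0 (1 / 2))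
    (ν := gaussianReal 0 (1 / 2))).comp
    (measurePreserving_complexGaussian.symm Complex.measurableEquivRealProd.symm)
  exact h

theorem measurePreserving_im : MeasurePreserving Complex.im complexGaussian
    (gaussianReal 0 (1 / 2)) := by
  have h := (measurePreserving_snd (μ := gaussianReal 0 (1 / 2))
    (ν := gaussianReal 0 (1 / 2))).comp
    (measurePreserving_complexGaussian.symm Complex.measurableEquivRealProd.symm)
  exact h

theorem measurePreserving_conj : MeasurePreserving (starRingEnd ℂ) complexGaussian
    complexGaussian := by
  have hneg : MeasurePreserving (fun x : ℝ => -x) (gaussianReal 0 (1 / 2))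
      (gaussianReal 0 (1 / 2)) := ⟨measurable_neg, by simp [gaussianReal_map_neg]⟩
  have h := (measurePreserving_complexGaussian.comp
    ((MeasurePreserving.id (gaussianReal 0 (1 / 2))).prod hneg)).comp
    (measurePreserving_complexGaussian.symm Complex.measurableEquivRealProd.symm)
  exact h

theorem memLp_re (p : ENNReal) (hp : p ≠ ⊤) : MemLp Complex.re p complexGaussian :=
  (memLp_id_gaussianReal' p hp).comp_measurePreserving measurePreserving_re

theorem memLp_im (p : ENNReal) (hp : p ≠ ⊤) : MemLp Complex.im p complexGaussian :=
  (memLp_id_gaussianReal' p hp).comp_measurePreserving measurePreserving_im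

theorem memLp_id_complexGaussian (p : ENNReal) (hp : p ≠ ⊤) :
    MemLp (fun z : ℂ => z) p complexGaussian := by
  have h := (memLp_re p hp).ofReal (K := ℂ) |>.add
    (((memLp_im p hp).ofReal (K := ℂ)).const_mul Complex.I)
  refine h.ae_eq (Eventually.of_forall fun z => ?_)
  simp [mul_comm Complex.I, Complex.re_add_im]

theorem integral_re_complexGaussian : ∫ z, z.re ∂complexGaussian = 0 := by
  rw [← integral_map (f := fun x : ℝ => x) measurePreserving_re.measurable.aemeasurable
    (by fun_prop), measurePreserving_re.map_eq, integral_id_gaussianReal]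

theorem integral_im_complexGaussian : ∫ z, z.im ∂complexGaussian = 0 := by
  rw [← integral_map (f := fun x : ℝ => x) measurePreserving_im.measurable.aemeasurable
    (by fun_prop), measurePreserving_im.map_eq, integral_id_gaussianReal]

theorem integral_sq_gaussianReal_half : ∫ x, x ^ 2 ∂(gaussianReal 0 (1 / 2)) = 1 / 2 := by
  have h := variance_of_integral_eq_zero (X := fun x : ℝ => x) (μ := gaussianReal 0 (1 / 2))
    aemeasurable_id (by simp)
  rw [← h]
  simp

theorem integral_re_sq_complexGaussian : ∫ z, z.re ^ 2 ∂complexGaussian = 1 / 2 := by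
  rw [← integral_map (f := fun x : ℝ => x ^ 2) measurePreserving_re.measurable.aemeasurable
    (by fun_prop), measurePreserving_re.map_eq, integral_sq_gaussianReal_half]

theorem integral_im_sq_complexGaussian : ∫ z, z.im ^ 2 ∂complexGaussian = 1 / 2 := by
  rw [← integral_map (f := fun x : ℝ => x ^ 2) measurePreserving_im.measurable.aemeasurable
    (by fun_prop), measurePreserving_im.map_eq, integral_sq_gaussianReal_half]

theorem integral_norm_sq_complexGaussian : ∫ z, ‖z‖ ^ 2 ∂complexGaussian = 1 := by
  have h1 := (memLp_re 2 (by simp)).integrable_sq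
  have h2 := (memLp_im 2 (by simp)).integrable_sq
  simp_rw [Complex.sq_norm, Complex.normSq_apply, ← pow_two]
  rw [integral_add h1 h2, integral_re_sq_complexGaussian, integral_im_sq_complexGaussian]
  norm_num

theorem memLp_mul_complexGaussian (a : ℂ) (p : ENNReal) (hp : p ≠ ⊤) :
    MemLp (fun z : ℂ => a * z) p complexGaussian :=
  (memLp_id_complexGaussian p hp).const_mul a

theorem variance_re_add_variance_im_mul (a : ℂ) :
    Var[fun z : ℂ => (a * z).re; complexGaussian] + Var[fun z : ℂ => (a * z).im; complexGaussian]
      = ‖a‖ ^ 2 := by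
  have hre := (memLp_re 1 (by simp)).integrable le_rfl
  have him := (memLp_im 1 (by simp)).integrable le_rfl
  rw [variance_of_integral_eq_zero (by fun_prop), variance_of_integral_eq_zero (by fun_prop)]
  · have h := memLp_mul_complexGaussian a 2 (by simp)
    rw [← integral_add]
    · have : ∀ z : ℂ, (a * z).re ^ 2 + (a * z).im ^ 2 = ‖a‖ ^ 2 * ‖z‖ ^ 2 := fun z => by
        rw [← mul_pow, ← norm_mul, Complex.sq_norm, Complex.normSq_apply]; ring
      simp_rw [this]
      rw [integral_const_mul, integral_norm_sq_complexGaussian, mul_one]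
    · exact h.re.integrable_sq
    · exact h.im.integrable_sq
  · simp only [Complex.mul_im]
    rw [integral_add (him.const_mul _) (hre.const_mul _), integral_const_mul, integral_const_mul,
      integral_re_complexGaussian, integral_im_complexGaussian]
    simp
  · simp only [Complex.mul_re]
    rw [integral_sub (hre.const_mul _) (him.const_mul _), integral_const_mul, integral_const_mul,
      integral_re_complexGaussian, integral_im_complexGaussian]
    simp

/-! ### Moments of linear combinations of independent Gaussian letters. -/

section Letter

variable {J : Type*} [Fintype J]

theorem memLp_linear (A : J → ℂ) (p : ENNReal) (hp : p ≠ ⊤) :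
    MemLp (fun ξ : J → ℂ => ∑ j, A j * ξ j) p (Measure.pi fun _ => complexGaussian) :=
  memLp_finsetSum _ fun j _ =>
    (memLp_mul_complexGaussian (A j) p hp).comp_measurePreserving
      (measurePreserving_eval (fun _ : J => complexGaussian) j)

theorem integral_linear_eq_zero (A : J → ℂ) :
    ∫ ξ : J → ℂ, ∑ j, A j * ξ j ∂(Measure.pi fun _ => complexGaussian) = 0 := by
  have h0 : ∫ z, z ∂complexGaussian = 0 := by
    have hi := (memLp_id_complexGaussian 1 (by simp)).integrable le_rfl
    apply Complex.ext
    · have := integral_re hi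
      simp only [RCLike.re_to_complex] at this
      rw [← this]; exact integral_re_complexGaussian
    · have := integral_im hi
      simp only [RCLike.im_to_complex] at this
      rw [← this]; exact integral_im_complexGaussian
  have hj : ∀ j, Integrable (fun ξ : J → ℂ => A j * ξ j) (Measure.pi fun _ => complexGaussian) :=
    fun j => ((memLp_mul_complexGaussian (A j) 1 (by simp)).comp_measurePreserving
      (measurePreserving_eval (fun _ : J => complexGaussian) j)).integrable le_rfl
  rw [integral_finsetSum _ fun j _ => hj j]
  refine Finset.sum_eq_zero fun j _ => ?_
  rw [integral_const_mul, integral_comp_eval (μ := fun _ : J => complexGaussian) (i := j) (f := fun z : ℂ => z)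
    aestronglyMeasurable_id, h0, mul_zero]

theorem integral_norm_sq_linear (A : J → ℂ) :
    ∫ ξ : J → ℂ, ‖∑ j, A j * ξ j‖ ^ 2 ∂(Measure.pi fun _ => complexGaussian)
      = ∑ j, ‖A j‖ ^ 2 := by
  set μ : Measure (J → ℂ) := Measure.pi fun _ => complexGaussian
  have h2 := memLp_linear A 2 (by simp)
  have hi := (memLp_linear A 1 (by simp)).integrable le_rfl
  have h0 := integral_linear_eq_zero A
  have hmr : AEMeasurable (fun ξ : J → ℂ => (∑ j, A j * ξ j).re) μ :=
    h2.re.aestronglyMeasurable.aemeasurable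
  have hmi : AEMeasurable (fun ξ : J → ℂ => (∑ j, A j * ξ j).im) μ :=
    h2.im.aestronglyMeasurable.aemeasurable
  have hre : Var[fun ξ : J → ℂ => (∑ j, A j * ξ j).re; μ]
      = ∑ j, Var[fun z : ℂ => (A j * z).re; complexGaussian] := by
    rw [← variance_sum_pi (μ := fun _ : J => complexGaussian)
      (X := fun j z => (A j * z).re) fun j => (memLp_mul_complexGaussian (A j) 2 (by simp)).re]
    congr 1; ext ξ; simp only [Finset.sum_apply, Complex.re_sum]
  have him : Var[fun ξ : J → ℂ => (∑ j, A j * ξ j).im; μ]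
      = ∑ j, Var[fun z : ℂ => (A j * z).im; complexGaussian] := by
    rw [← variance_sum_pi (μ := fun _ : J => complexGaussian)
      (X := fun j z => (A j * z).im) fun j => (memLp_mul_complexGaussian (A j) 2 (by simp)).im]
    congr 1; ext ξ; simp only [Finset.sum_apply, Complex.im_sum]
  rw [variance_of_integral_eq_zero hmr] at hre
  · rw [variance_of_integral_eq_zero hmi] at him
    · simp_rw [Complex.sq_norm, Complex.normSq_apply, ← pow_two]
      refine ((integral_add h2.re.integrable_sq h2.im.integrable_sq).trans
        (congrArg₂ (· + ·) hre him)).trans ?_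
      rw [← Finset.sum_add_distrib]
      refine Finset.sum_congr rfl fun j _ => ?_
      rw [variance_re_add_variance_im_mul, Complex.sq_norm, Complex.normSq_apply, pow_two, pow_two]
    · have := integral_im hi
      simp only [RCLike.im_to_complex] at this
      rw [this, h0]; rfl
  · have := integral_re hi
    simp only [RCLike.re_to_complex] at this
    rw [this, h0]; rfl

theorem memLp_norm_sq_linear (A : J → ℂ) :
    MemLp (fun ξ : J → ℂ => ‖∑ j, A j * ξ j‖ ^ 2) 2 (Measure.pi fun _ => complexGaussian) := by
  have h := memLp_linear A 4 (by simp)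
  refine (memLp_two_iff_integrable_sq (h.aestronglyMeasurable.norm.pow 2)).2 ?_
  have := MemLp.integrable_norm_pow (p := 4) (by exact_mod_cast h) (by norm_num)
  refine this.congr (Eventually.of_forall fun ξ => ?_)
  simp only [Pi.pow_apply]
  ring

end Letter

/-! ### Independent Gaussian vectors -/

/-- Law of independent vectors, indexed by `τ`, with `N` i.i.d. `CN(0,1)` entries each. -/
noncomputable abbrev streams (τ : Type*) [Fintype τ] (N : ℕ) : Measure (τ → Fin N → ℂ) :=
  Measure.pi fun _ => Measure.pi fun _ => complexGaussian

/-- Squared Euclidean norm of a block of channel symbols. -/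
noncomputable def energy {N : ℕ} (v : Fin N → ℂ) : ℝ := ∑ i, ‖v i‖ ^ 2

/-- Linear combination of the blocks `x j` with coefficients `A j`. -/
noncomputable def comb {J : Type*} [Fintype J] {N : ℕ} (A : J → ℂ) (x : J → Fin N → ℂ) : Fin N → ℂ :=
  fun i => ∑ j, A j * x j i

@[fun_prop]
theorem measurable_energy {N : ℕ} : Measurable (energy (N := N)) := by
  unfold energy; fun_prop

@[fun_prop]
theorem measurable_comb {J : Type*} [Fintype J] {N : ℕ} (A : J → ℂ) :
    Measurable (comb (N := N) A) := by
  unfold comb; fun_prop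

theorem energy_nonneg {N : ℕ} (v : Fin N → ℂ) : 0 ≤ energy v :=
  Finset.sum_nonneg fun _ _ => by positivity

/-- Exchanging the block and time indices turns the energy into a sum of `N` i.i.d. letters, square
integrable because Gaussians have fourth moments. Chebyshev's inequality then applies. -/
theorem energy_deviation {J : Type*} [Fintype J] (A : J → ℂ) {δ : ℝ} (hδ : 0 < δ) {N : ℕ}
    (hN : 0 < N) :
    (streams J N).real {x | N * δ ≤ |energy (comb A x) - N * ∑ j, ‖A j‖ ^ 2|} ≤
      Var[fun ξ : J → ℂ => ‖∑ j, A j * ξ j‖ ^ 2; Measure.pi fun _ => complexGaussian]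
        / δ ^ 2 / N := by
  set f : (J → ℂ) → ℝ := fun ξ => ‖∑ j, A j * ξ j‖ ^ 2 with hf
  set μ : Measure (J → ℂ) := Measure.pi fun _ => complexGaussian
  have hmem : MemLp f 2 μ := memLp_norm_sq_linear A
  let X : (Fin N → J → ℂ) → ℝ := ∑ i : Fin N, fun y => f (y i)
  have hX : MemLp X 2 (Measure.pi fun _ : Fin N => μ) := memLp_finsetSum' _ fun i _ =>
    hmem.comp_measurePreserving (measurePreserving_eval (fun _ : Fin N => μ) i)
  have hvar : Var[X; Measure.pi fun _ : Fin N => μ] = N * Var[f; μ] := by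
    rw [variance_sum_pi (X := fun _ => f) fun _ => hmem]; simp
  have hmean : ∫ y, X y ∂(Measure.pi fun _ : Fin N => μ) = N * ∑ j, ‖A j‖ ^ 2 := by
    have h1 : ∀ i : Fin N, Integrable (fun y : Fin N → J → ℂ => f (y i))
        (Measure.pi fun _ => μ) := fun i =>
      (hmem.comp_measurePreserving
        (measurePreserving_eval (fun _ : Fin N => μ) i)).integrable one_le_two
    simp only [X, Finset.sum_apply]
    rw [integral_finsetSum _ fun i _ => h1 i]
    have h2 : ∀ i : Fin N, ∫ y : Fin N → J → ℂ, f (y i) ∂(Measure.pi fun _ => μ)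
        = ∑ j, ‖A j‖ ^ 2 := fun i => by
      rw [integral_comp_eval (μ := fun _ : Fin N => μ) hmem.aestronglyMeasurable]
      exact integral_norm_sq_linear A
    simp [h2]
  have hmp := measurePreserving_swap_pi (ι := J) (κ := Fin N) complexGaussian
  have hset : {x : J → Fin N → ℂ | N * δ ≤ |energy (comb A x) - N * ∑ j, ‖A j‖ ^ 2|}
      = (fun x i j => x j i) ⁻¹'
        {y | N * δ ≤ |X y - ∫ y, X y ∂(Measure.pi fun _ : Fin N => μ)|} := by
    rw [hmean]
    ext x
    simp [X, hf, energy, comb]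
  have hXm : Measurable X := by
    have : Measurable f := by fun_prop
    have hX' : X = fun y => ∑ i, f (y i) := by ext y; simp [X]
    rw [hX']
    exact Finset.measurable_sum _ fun i _ => this.comp (measurable_pi_apply i)
  have hN' : (0 : ℝ) < N := by exact_mod_cast hN
  rw [hset, measureReal_def, hmp.measure_preimage]
  · refine ENNReal.toReal_le_of_le_ofReal ?_ ((meas_ge_le_variance_div_sq hX
      (by positivity)).trans (ENNReal.ofReal_le_ofReal ?_))
    · have := variance_nonneg f μ
      positivity
    · rw [hvar]
      refine le_of_eq ?_
      field_simp
  · exact (measurableSet_le measurable_const (hXm.sub_const _).abs).nullMeasurableSet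

/-! ### Gaussian codewords far from the received block -/

theorem integral_exp_neg_mul_sq_gaussianReal_half {s : ℝ} (hs : 0 ≤ s) (b : ℝ) :
    ∫ x, Real.exp (-s * (b - x) ^ 2) ∂(gaussianReal 0 (1 / 2))
      = (√(1 + s))⁻¹ * Real.exp (-s * b ^ 2 / (1 + s)) := by
  have h1 : (0 : ℝ) < 1 + s := by linarith
  rw [integral_gaussianReal_eq_integral_smul (by norm_num)]
  -- Completing the square: `x² + s(b - x)² = (1 + s)(x - sb/(1 + s))² + sb²/(1 + s)`.
  have hpt : ∀ x : ℝ, gaussianPDFReal 0 (1 / 2) x • Real.exp (-s * (b - x) ^ 2)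
      = ((√Real.pi)⁻¹ * Real.exp (-s * b ^ 2 / (1 + s))) *
        Real.exp (-(1 + s) * (x - s * b / (1 + s)) ^ 2) := fun x => by
    rw [gaussianPDFReal, smul_eq_mul]
    have e1 : (2 * Real.pi * ((1 / 2 : NNReal) : ℝ)) = Real.pi := by push_cast; ring
    rw [e1, mul_assoc, mul_assoc, ← Real.exp_add, ← Real.exp_add]
    congr 2
    push_cast
    field_simp
    ring
  simp_rw [hpt]
  rw [integral_const_mul, integral_sub_right_eq_self (fun x => Real.exp (-(1 + s) * x ^ 2)),
    integral_gaussian, Real.sqrt_div Real.pi_pos.le]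
  have : √Real.pi ≠ 0 := (Real.sqrt_pos.2 Real.pi_pos).ne'
  have : √(1 + s) ≠ 0 := (Real.sqrt_pos.2 h1).ne'
  field_simp

theorem integral_exp_neg_mul_norm_sq_complexGaussian {s : ℝ} (hs : 0 ≤ s) (b : ℂ) :
    ∫ z, Real.exp (-s * ‖b - z‖ ^ 2) ∂complexGaussian
      = (1 + s)⁻¹ * Real.exp (-s * ‖b‖ ^ 2 / (1 + s)) := by
  have h1 : (0 : ℝ) < 1 + s := by linarith
  rw [← measurePreserving_complexGaussian.integral_comp']
  have hpt : ∀ p : ℝ × ℝ, Real.exp (-s * ‖b - Complex.measurableEquivRealProd.symm p‖ ^ 2)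
      = Real.exp (-s * (b.re - p.1) ^ 2) * Real.exp (-s * (b.im - p.2) ^ 2) := fun p => by
    rw [← Real.exp_add, Complex.sq_norm, Complex.normSq_apply]
    congr 1
    change -s * ((b.re - p.1) * (b.re - p.1) + (b.im - p.2) * (b.im - p.2)) = _
    ring
  simp_rw [hpt]
  rw [integral_prod_mul (fun x => Real.exp (-s * (b.re - x) ^ 2))
    (fun y => Real.exp (-s * (b.im - y) ^ 2)), integral_exp_neg_mul_sq_gaussianReal_half hs,
    integral_exp_neg_mul_sq_gaussianReal_half hs, mul_mul_mul_comm, ← Real.exp_add, ← mul_inv,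
    Real.mul_self_sqrt h1.le, Complex.sq_norm, Complex.normSq_apply]
  congr 2
  ring

theorem integral_exp_neg_mul_norm_sub_mul_sq {s : ℝ} (hs : 0 ≤ s) (a b : ℂ) :
    ∫ z, Real.exp (-s * ‖b - a * z‖ ^ 2) ∂complexGaussian
      = (1 + s * ‖a‖ ^ 2)⁻¹ * Real.exp (-s * ‖b‖ ^ 2 / (1 + s * ‖a‖ ^ 2)) := by
  rcases eq_or_ne a 0 with rfl | ha
  · simp
  · have hpt : ∀ z : ℂ, -s * ‖b - a * z‖ ^ 2 = -(s * ‖a‖ ^ 2) * ‖b / a - z‖ ^ 2 := fun z => by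
      rw [show b - a * z = a * (b / a - z) by field_simp, norm_mul]; ring
    simp_rw [hpt]
    rw [integral_exp_neg_mul_norm_sq_complexGaussian (by positivity), norm_div]
    have : ‖a‖ ≠ 0 := norm_ne_zero_iff.2 ha
    congr 2
    field_simp

/-- Chernoff bound for a fixed block `u`: the exponential moment of the energy factors over the
independent letters, each a Gaussian integral. -/
theorem measure_energy_sub_le {N : ℕ} (a : ℂ) (u : Fin N → ℂ) {s : ℝ} (hs : 0 ≤ s) (T : ℝ) :
    (Measure.pi fun _ : Fin N => complexGaussian).real {x | energy (u - a • x) ≤ N * T} ≤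
      Real.exp (s * (N * T) - N * Real.log (1 + s * ‖a‖ ^ 2)
        - s * energy u / (1 + s * ‖a‖ ^ 2)) := by
  set ν := Measure.pi fun _ : Fin N => complexGaussian
  have hpos : 0 < 1 + s * ‖a‖ ^ 2 := by positivity
  have hexp : ∀ x : Fin N → ℂ, Real.exp (-s * energy (u - a • x))
      = ∏ i, Real.exp (-s * ‖u i - a * x i‖ ^ 2) := fun x => by
    rw [← Real.exp_sum, energy, Finset.mul_sum]; rfl
  have hint : Integrable (fun x : Fin N → ℂ => Real.exp (-s * energy (u - a • x))) ν := by
    refine Integrable.of_bound (C := 1) (Measurable.aestronglyMeasurable (by fun_prop)) (Eventually.of_forall fun x => ?_)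
    rw [Real.norm_eq_abs, Real.abs_exp, Real.exp_le_one_iff]
    have := energy_nonneg (u - a • x)
    nlinarith
  have h := measure_le_le_exp_mul_mgf (μ := ν) (X := fun x => energy (u - a • x)) (t := -s)
    (N * T) (by linarith) hint
  refine h.trans (le_of_eq ?_)
  rw [mgf]
  simp_rw [hexp]
  rw [integral_fintype_prod_eq_prod (fun i z => Real.exp (-s * ‖u i - a * z‖ ^ 2))]
  simp_rw [integral_exp_neg_mul_norm_sub_mul_sq hs]
  rw [Finset.prod_mul_distrib, ← Real.exp_sum, Finset.prod_const, Finset.card_univ,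
    Fintype.card_fin, sub_eq_add_neg, sub_eq_add_neg, Real.exp_add, Real.exp_add, mul_assoc]
  congr 1
  · ring_nf
  · congr 1
    · rw [inv_pow, Real.exp_neg, ← Real.log_pow, Real.exp_log (by positivity)]
    · rw [energy, ← Finset.sum_div, ← Finset.mul_sum]; ring_nf

/-- Since `ψ` avoids `t`, the false codeword is independent of the observed block. Conditioning on
the latter by Fubini leaves the Chernoff bound, which decreases in the observed energy and so is
worst at `N * S`. -/
theorem false_codeword_le {J τ : Type*} [Fintype J] [Fintype τ] {N : ℕ} (A : J → ℂ)
    {ψ : J → τ} (hψ : Function.Injective ψ) {t : τ} (ht : ∀ j, ψ j ≠ t) (a : ℂ) {s : ℝ}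
    (hs : 0 ≤ s) (S T : ℝ) :
    (streams τ N).real {x | N * S ≤ energy (comb A (fun j => x (ψ j))) ∧
        energy (comb A (fun j => x (ψ j)) - a • x t) ≤ N * T} ≤
      Real.exp (N * (s * T - Real.log (1 + s * ‖a‖ ^ 2) - s * S / (1 + s * ‖a‖ ^ 2))) := by
  have hinj : Function.Injective (Sum.elim ψ (fun _ : Unit => t)) :=
    hψ.sumElim (Function.injective_of_subsingleton _) fun j _ => ht j
  have h1 := measurePreserving_precomp (Measure.pi fun _ : Fin N => complexGaussian) hinj
  have h2 := measurePreserving_sumPiEquivProdPi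
    (fun _ : J ⊕ Unit => Measure.pi fun _ : Fin N => complexGaussian)
  have h3 := h2.comp h1
  set E : Set ((J → Fin N → ℂ) × (Unit → Fin N → ℂ)) :=
    {p | N * S ≤ energy (comb A p.1) ∧ energy (comb A p.1 - a • p.2 ()) ≤ N * T} with hE
  have hEm : MeasurableSet E := by
    have hm1 : Measurable fun p : (J → Fin N → ℂ) × (Unit → Fin N → ℂ) => comb A p.1 :=
      (measurable_comb A).comp measurable_fst
    have hm2 : Measurable fun p : (J → Fin N → ℂ) × (Unit → Fin N → ℂ) => a • p.2 () := by
      fun_prop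
    exact (measurableSet_le measurable_const (measurable_energy.comp hm1)).inter
      (measurableSet_le (measurable_energy.comp (hm1.sub hm2)) measurable_const)
  have hset : {x : τ → Fin N → ℂ | N * S ≤ energy (comb A (fun j => x (ψ j))) ∧
        energy (comb A (fun j => x (ψ j)) - a • x t) ≤ N * T}
      = (MeasurableEquiv.sumPiEquivProdPi (fun _ : J ⊕ Unit => Fin N → ℂ) ∘
          fun ω k => ω (Sum.elim ψ (fun _ : Unit => t) k)) ⁻¹' E := rfl
  set K := Real.exp (N * (s * T - Real.log (1 + s * ‖a‖ ^ 2) - s * S / (1 + s * ‖a‖ ^ 2)))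
  rw [hset, measureReal_def, h3.measure_preimage hEm.nullMeasurableSet]
  refine ENNReal.toReal_le_of_le_ofReal (Real.exp_pos _).le ?_
  rw [Measure.prod_apply hEm]
  refine (lintegral_mono (g := fun _ => ENNReal.ofReal K) fun u => ?_).trans (by simp)
  by_cases hu : N * S ≤ energy (comb A u)
  · have hpre : Prod.mk u ⁻¹' E = (fun ω => ω ()) ⁻¹'
        {x | energy (comb A u - a • x) ≤ N * T} := by
      ext y; simp [hE, hu]
    rw [hpre, (measurePreserving_eval (fun _ : Unit => Measure.pi fun _ : Fin N => complexGaussian)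
      ()).measure_preimage (measurableSet_le (by fun_prop) measurable_const).nullMeasurableSet]
    rw [← ofReal_measureReal]
    refine ENNReal.ofReal_le_ofReal ((measure_energy_sub_le a _ hs T).trans
      (Real.exp_le_exp.2 ?_))
    have hpos : 0 < 1 + s * ‖a‖ ^ 2 := by positivity
    have : s * (N * S) / (1 + s * ‖a‖ ^ 2) ≤ s * energy (comb A u) / (1 + s * ‖a‖ ^ 2) := by
      gcongr
    calc _ ≤ s * (N * T) - N * Real.log (1 + s * ‖a‖ ^ 2) - s * (N * S) / (1 + s * ‖a‖ ^ 2) := by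
          linarith
      _ = _ := by ring
  · have hpre : Prod.mk u ⁻¹' E = ∅ := by
      ext y; simp [hE, hu]
    simp [hpre]

/-! ### Threshold decoding -/

/-- The event that `w` is not the only message `m` for which `a • book m` is within squared
distance `N * T` of `u`. -/
def DecodingFails {N M : ℕ} (a : ℂ) (T : ℝ) (book : Fin M → Fin N → ℂ) (w : Fin M)
    (u : Fin N → ℂ) : Prop :=
  N * T < energy (u - a • book w) ∨ ∃ m, m ≠ w ∧ energy (u - a • book m) ≤ N * T

theorem comb_sub_smul {J : Type*} [Fintype J] [DecidableEq J] {N : ℕ} (A : J → ℂ) (j₀ : J)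
    (x : J → Fin N → ℂ) :
    comb A x - A j₀ • x j₀ = comb (Function.update A j₀ 0) x := by
  ext i
  simp only [comb, Pi.sub_apply, Pi.smul_apply, smul_eq_mul]
  rw [← Finset.add_sum_erase _ _ (Finset.mem_univ j₀),
    ← Finset.add_sum_erase _ (fun j => Function.update A j₀ 0 j * x j i) (Finset.mem_univ j₀)]
  simp only [Function.update_self, zero_mul, zero_add, add_sub_cancel_left]
  refine Finset.sum_congr rfl fun j hj => ?_
  rw [Function.update_of_ne (Finset.ne_of_mem_erase hj)]

theorem sum_norm_sq_update {J : Type*} [Fintype J] [DecidableEq J] (A : J → ℂ) (j₀ : J) :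
    ∑ j, ‖A j‖ ^ 2 = ∑ j, ‖Function.update A j₀ 0 j‖ ^ 2 + ‖A j₀‖ ^ 2 := by
  rw [← Finset.add_sum_erase _ _ (Finset.mem_univ j₀),
    ← Finset.add_sum_erase _ (fun j => ‖Function.update A j₀ 0 j‖ ^ 2) (Finset.mem_univ j₀)]
  simp only [Function.update_self, norm_zero, ne_eq, OfNat.ofNat_ne_zero, not_false_eq_true,
    zero_pow, zero_add]
  rw [add_comm]
  congr 1
  refine Finset.sum_congr rfl fun j hj => ?_
  rw [Function.update_of_ne (Finset.ne_of_mem_erase hj)]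

/-- The constant in the Chebyshev bound `energy_deviation`. -/
noncomputable def letterVariance {J : Type*} [Fintype J] (A : J → ℂ) : ℝ :=
  Var[fun ξ : J → ℂ => ‖∑ j, A j * ξ j‖ ^ 2; Measure.pi fun _ => complexGaussian]

theorem energy_deviation_precomp {J τ : Type*} [Fintype J] [Fintype τ] (A : J → ℂ)
    {ψ : J → τ} (hψ : Function.Injective ψ) {δ : ℝ} (hδ : 0 < δ) {N : ℕ} (hN : 0 < N) :
    (streams τ N).real {x | N * δ ≤ |energy (comb A fun j => x (ψ j)) - N * ∑ j, ‖A j‖ ^ 2|} ≤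
      letterVariance A / δ ^ 2 / N := by
  have hmp := measurePreserving_precomp (Measure.pi fun _ : Fin N => complexGaussian) hψ
  refine le_of_eq_of_le ?_ (energy_deviation A hδ hN)
  rw [measureReal_def, measureReal_def, ← hmp.measure_preimage]
  · rfl
  · exact (measurableSet_le measurable_const (by fun_prop)).nullMeasurableSet

/-- `Function.update A j₀ 0` describes what remains once the true codeword is removed. Failure
requires that this remainder has too much energy, that the whole observation has too little, or that
one of the `M - 1` false codewords comes close. -/
theorem decodingFails_le {J τ : Type*} [Fintype J] [DecidableEq J] [Fintype τ] {N M : ℕ}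
    (hN : 0 < N) (A : J → ℂ) (j₀ : J) {ψ : J → τ} (hψ : Function.Injective ψ)
    {bk : Fin M → τ} {w : Fin M} (hw : ψ j₀ = bk w) (hm : ∀ m, m ≠ w → ∀ j, ψ j ≠ bk m)
    {δ s : ℝ} (hδ : 0 < δ) (hs : 0 ≤ s) :
    (streams τ N).real {x | DecodingFails (A j₀)
        (∑ j, ‖Function.update A j₀ 0 j‖ ^ 2 + δ) (fun m => x (bk m)) w
        (comb A fun j => x (ψ j))} ≤
      letterVariance (Function.update A j₀ 0) / δ ^ 2 / N + letterVariance A / δ ^ 2 / N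
      + (M - 1 : ℝ) * Real.exp (N * (s * (∑ j, ‖Function.update A j₀ 0 j‖ ^ 2 + δ)
        - Real.log (1 + s * ‖A j₀‖ ^ 2)
        - s * (∑ j, ‖A j‖ ^ 2 - δ) / (1 + s * ‖A j₀‖ ^ 2))) := by
  set A' := Function.update A j₀ 0
  set T := ∑ j, ‖A' j‖ ^ 2 + δ with hT
  set S := ∑ j, ‖A j‖ ^ 2 - δ with hS
  set P := streams τ N
  set E1 : Set (τ → Fin N → ℂ) :=
    {x | N * δ ≤ |energy (comb A' fun j => x (ψ j)) - N * ∑ j, ‖A' j‖ ^ 2|}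
  set E2 : Set (τ → Fin N → ℂ) :=
    {x | N * δ ≤ |energy (comb A fun j => x (ψ j)) - N * ∑ j, ‖A j‖ ^ 2|}
  set E3 : Fin M → Set (τ → Fin N → ℂ) := fun m =>
    {x | N * S ≤ energy (comb A (fun j => x (ψ j))) ∧
        energy (comb A (fun j => x (ψ j)) - A j₀ • x (bk m)) ≤ N * T}
  have hsub : {x | DecodingFails (A j₀) T (fun m => x (bk m)) w (comb A fun j => x (ψ j))}
      ⊆ (E1 ∪ E2) ∪ ⋃ m ∈ Finset.univ.erase w, E3 m := by
    rintro x (h | ⟨m, hmw, h⟩)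
    · left; left
      change N * T < energy (comb A (fun j => x (ψ j)) - A j₀ • x (bk w)) at h
      rw [← hw, comb_sub_smul A j₀ fun j => x (ψ j)] at h
      change N * δ ≤ |energy (comb A' fun j => x (ψ j)) - N * ∑ j, ‖A' j‖ ^ 2|
      refine le_trans ?_ (le_abs_self _)
      rw [hT] at h
      change N * δ ≤ energy (comb A' fun j => x (ψ j)) - _
      linarith
    · by_cases h2 : N * S ≤ energy (comb A (fun j => x (ψ j)))
      · right
        simp only [Set.mem_iUnion]
        exact ⟨m, by simp [hmw], h2, h⟩
      · left; right
        change N * δ ≤ |energy (comb A fun j => x (ψ j)) - N * ∑ j, ‖A j‖ ^ 2|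
        refine le_trans ?_ (neg_le_abs _)
        rw [hS] at h2
        linarith
  have hM : (1 : ℝ) ≤ M := by exact_mod_cast Fin.pos w
  calc P.real _ ≤ P.real ((E1 ∪ E2) ∪ ⋃ m ∈ Finset.univ.erase w, E3 m) :=
        measureReal_mono hsub
    _ ≤ (P.real E1 + P.real E2) + ∑ m ∈ Finset.univ.erase w, P.real (E3 m) :=
        (measureReal_union_le _ _).trans (add_le_add (measureReal_union_le _ _)
          (measureReal_biUnion_finset_le _ _))
    _ ≤ _ := by
        refine add_le_add (add_le_add (energy_deviation_precomp A' hψ hδ hN)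
          (energy_deviation_precomp A hψ hδ hN)) ?_
        refine (Finset.sum_le_card_nsmul _ _ _ fun m hmm =>
          false_codeword_le A hψ (hm m (Finset.ne_of_mem_erase hmm)) (A j₀) hs S T).trans ?_
        rw [nsmul_eq_mul, Finset.card_erase_of_mem (Finset.mem_univ _), Finset.card_univ,
          Fintype.card_fin, Nat.cast_sub (Fin.pos w), Nat.cast_one]

theorem eventually_div_natCast_le (K : ℝ) {ε : ℝ} (hε : 0 < ε) :
    ∀ᶠ N : ℕ in atTop, K / N ≤ ε :=
  (tendsto_const_div_atTop_nhds_zero_nat K).eventually_le_const hε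

/-- Random coding at rates below `log(1 + SNR)`. Rate zero is allowed separately because a power of
zero may leave no positive rate. The Chebyshev constants depend on `A` alone, so the threshold
precedes `ε` and the bound is uniform in messages and index types. -/
theorem eventually_decodingFails_le {J : Type*} [Fintype J] [DecidableEq J] (A : J → ℂ) (j₀ : J)
    {r : ℝ} (hr : r = 0 ∨ 0 < r ∧
      r < Real.logb 2 (1 + ‖A j₀‖ ^ 2 / ∑ j, ‖Function.update A j₀ 0 j‖ ^ 2)) :
    ∃ T : ℝ, ∀ ε : ℝ, 0 < ε → ∀ᶠ N : ℕ in atTop, ∀ (τ : Type) [Fintype τ] (M : ℕ)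
      (ψ : J → τ) (bk : Fin M → τ) (w : Fin M), M = ⌈(2 : ℝ) ^ (N * r)⌉₊ →
      Function.Injective ψ → ψ j₀ = bk w → (∀ m, m ≠ w → ∀ j, ψ j ≠ bk m) →
      (streams τ N).real {x | DecodingFails (A j₀) T (fun m => x (bk m)) w
        (comb A fun j => x (ψ j))} ≤ ε := by
  set v := ∑ j, ‖Function.update A j₀ 0 j‖ ^ 2 with hv
  rcases hr with rfl | ⟨hr0, hr⟩
  -- At rate zero the book has one codeword, so there are no false ones and any positive slack
  -- works.
  · refine ⟨v + 1, fun ε hε => ?_⟩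
    filter_upwards [eventually_gt_atTop 0, eventually_div_natCast_le
      (letterVariance (Function.update A j₀ 0) / 1 ^ 2) (half_pos hε),
      eventually_div_natCast_le (letterVariance A / 1 ^ 2) (half_pos hε)] with N hN h1 h2
    intro τ _ M ψ bk w hM hψ hw hm
    have := decodingFails_le hN A j₀ hψ hw hm one_pos le_rfl
    have hM1 : M = 1 := by simpa using hM
    subst hM1
    simp only [Nat.cast_one, sub_self, zero_mul, add_zero] at this
    linarith
  · have hv0 : 0 < v := by
      -- If `v = 0`, the quotient has the default value `0` and the rate bound becomes `r < log 1 =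
      -- 0`.
      rcases (Finset.sum_nonneg fun j _ => by positivity : 0 ≤ v).eq_or_lt with h | h
      · rw [← hv] at h
        rw [← h, div_zero, add_zero, Real.logb_one] at hr
        exact absurd hr0 hr.not_gt
      · exact h
    set C := Real.log (1 + ‖A j₀‖ ^ 2 / v) with hC
    have hlog2 : 0 < Real.log 2 := Real.log_pos one_lt_two
    have hrC : r * Real.log 2 < C := by
      rwa [Real.logb, lt_div_iff₀ hlog2] at hr
    set γ := C - r * Real.log 2 with hγ
    have hγ0 : 0 < γ := sub_pos.2 hrC
    -- With `s = 1/v`, each of the two uses of this slack costs at most `γ/4` in the exponent. Of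
    -- the gap `γ` between capacity and rate, `γ/2` remains.
    have hδ : 0 < v * γ / 4 := by positivity
    refine ⟨v + v * γ / 4, fun ε hε => ?_⟩
    have hexp : Tendsto (fun N : ℕ => Real.exp (-(N * (γ / 2)))) atTop (nhds 0) :=
      Real.tendsto_exp_neg_atTop_nhds_zero.comp
        (tendsto_natCast_atTop_atTop.atTop_mul_const (half_pos hγ0))
    have hε3 : 0 < ε / 3 := by positivity
    filter_upwards [eventually_gt_atTop 0, eventually_div_natCast_le
      (letterVariance (Function.update A j₀ 0) / (v * γ / 4) ^ 2) hε3,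
      eventually_div_natCast_le (letterVariance A / (v * γ / 4) ^ 2) hε3,
      hexp.eventually_le_const hε3] with N hN h1 h2 h3
    intro τ _ M ψ bk w hM hψ hw hm
    -- `s = 1/v` optimizes the Chernoff exponent without slack, whose value is then minus the
    -- capacity `C`.
    have key := decodingFails_le hN A j₀ hψ hw hm hδ (inv_pos.2 hv0).le
    refine key.trans ?_
    have hMle : (M : ℝ) - 1 ≤ Real.exp (N * (r * Real.log 2)) := by
      have := (Nat.ceil_lt_add_one (a := (2 : ℝ) ^ (N * r)) (by positivity)).le
      rw [← hM, Real.rpow_def_of_pos two_pos] at this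
      rw [show (N : ℝ) * (r * Real.log 2) = Real.log 2 * (N * r) by ring]
      linarith
    have hexpo : v⁻¹ * (v + v * γ / 4) - Real.log (1 + v⁻¹ * ‖A j₀‖ ^ 2)
        - v⁻¹ * (∑ j, ‖A j‖ ^ 2 - v * γ / 4) / (1 + v⁻¹ * ‖A j₀‖ ^ 2) ≤ γ / 2 - C := by
      rw [sum_norm_sq_update A j₀, ← hv, hC, div_eq_inv_mul (‖A j₀‖ ^ 2)]
      set q := v⁻¹ * ‖A j₀‖ ^ 2 with hq
      have hq0 : 0 ≤ q := by positivity
      have e1 : v⁻¹ * (v + v * γ / 4) = 1 + γ / 4 := by field_simp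
      have e2 : v⁻¹ * (v + ‖A j₀‖ ^ 2 - v * γ / 4) = 1 + q - γ / 4 := by
        rw [hq]; field_simp
      have e3 : (1 + q - γ / 4) / (1 + q) = 1 - γ / 4 / (1 + q) := by field_simp
      rw [e1, e2, e3]
      have : γ / 4 / (1 + q) ≤ γ / 4 := div_le_self (by positivity) (by linarith)
      linarith
    have h4 : (M - 1 : ℝ) * Real.exp (N * (v⁻¹ * (v + v * γ / 4)
        - Real.log (1 + v⁻¹ * ‖A j₀‖ ^ 2)
        - v⁻¹ * (∑ j, ‖A j‖ ^ 2 - v * γ / 4) / (1 + v⁻¹ * ‖A j₀‖ ^ 2))) ≤ ε / 3 := by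
      refine le_trans ?_ h3
      calc _ ≤ Real.exp (N * (r * Real.log 2)) * Real.exp (N * (γ / 2 - C)) := by gcongr
        _ = _ := by rw [← Real.exp_add, hγ]; ring_nf
    linarith

theorem eventually_energy_gt_le {J : Type*} [Fintype J] (A : J → ℂ) (hA : ∑ j, ‖A j‖ ^ 2 < 1)
    {ε : ℝ} (hε : 0 < ε) :
    ∀ᶠ N : ℕ in atTop, ∀ (τ : Type) [Fintype τ] (ψ : J → τ), Function.Injective ψ →
      (streams τ N).real {x | N < energy (comb A fun j => x (ψ j))} ≤ ε := by
  have hδ := sub_pos.2 hA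
  filter_upwards [eventually_gt_atTop 0, eventually_div_natCast_le
    (letterVariance A / (1 - ∑ j, ‖A j‖ ^ 2) ^ 2) hε] with N hN h1
  intro τ _ ψ hψ
  refine (measureReal_mono fun x hx => ?_).trans
    ((energy_deviation_precomp A hψ hδ hN).trans h1)
  change N * (1 - ∑ j, ‖A j‖ ^ 2) ≤ |energy (comb A fun j => x (ψ j)) - N * ∑ j, ‖A j‖ ^ 2|
  refine le_trans ?_ (le_abs_self _)
  have : (N : ℝ) < energy (comb A fun j => x (ψ j)) := hx
  linarith

/-- Threshold decoding: a message `m` with `a • book m` within squared distance `N * T` of `u`. -/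
noncomputable def thresholdDecode {N M : ℕ} [Nonempty (Fin M)] (a : ℂ) (T : ℝ)
    (book : Fin M → Fin N → ℂ) (u : Fin N → ℂ) : Fin M :=
  Classical.epsilon fun m => energy (u - a • book m) ≤ N * T

theorem thresholdDecode_eq {N M : ℕ} [Nonempty (Fin M)] {a : ℂ} {T : ℝ}
    {book : Fin M → Fin N → ℂ} {w : Fin M} {u : Fin N → ℂ} (h : ¬ DecodingFails a T book w u) :
    thresholdDecode a T book u = w := by
  simp only [DecodingFails, not_or, not_lt, not_exists, not_and, not_le] at h
  have h1 := Classical.epsilon_spec (p := fun m => energy (u - a • book m) ≤ N * T) ⟨w, h.1⟩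
  by_contra hne
  exact absurd h1 (h.2 _ hne).not_ge

theorem measurable_thresholdDecode {N M : ℕ} [Nonempty (Fin M)] (a : ℂ) (T : ℝ)
    (book : Fin M → Fin N → ℂ) : Measurable (thresholdDecode a T book) := by
  have h1 : Measurable fun (u : Fin N → ℂ) (m : Fin M) => energy (u - a • book m) ≤ N * T := by
    refine measurable_pi_iff.2 fun m => ?_
    have hm : Measurable fun u : Fin N → ℂ => energy (u - a • book m) := by fun_prop
    exact measurableSet_setOfPred.1 (measurableSet_le hm measurable_const)
  exact (measurable_of_finite fun p : Fin M → Prop => Classical.epsilon p).comp h1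

theorem measurableSet_decodingFails {Ω : Type*} [MeasurableSpace Ω] {N M : ℕ} (a : ℂ) (T : ℝ)
    {book : Ω → Fin M → Fin N → ℂ} (w : Fin M) {u : Ω → Fin N → ℂ} (hbook : Measurable book)
    (hu : Measurable u) : MeasurableSet {ω | DecodingFails a T (book ω) w (u ω)} := by
  have hm : ∀ m, Measurable fun ω => energy (u ω - a • book ω m) := fun m =>
    measurable_energy.comp (hu.sub (((measurable_pi_apply m).comp hbook).const_smul a))
  refine (measurableSet_lt measurable_const (hm w)).union ?_
  have : {ω | ∃ m, m ≠ w ∧ energy (u ω - a • book ω m) ≤ N * T}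
      = ⋃ m, ⋃ (_ : m ≠ w), {ω | energy (u ω - a • book ω m) ≤ N * T} := by
    ext ω; simp
  change MeasurableSet {ω | ∃ m, m ≠ w ∧ energy (u ω - a • book ω m) ≤ N * T}
  rw [this]
  exact MeasurableSet.iUnion fun m => MeasurableSet.iUnion fun _ =>
    measurableSet_le (hm m) measurable_const

/-! ### Codes made of two blocks -/

/-- The time of the `i`-th channel use of block `s`. -/
def blockIndex {N r : ℕ} (s : Fin 2) (i : Fin N) : Fin (N + N + r) :=
  ⟨s * N + i, by have := i.2; fin_cases s <;> simp <;> omega⟩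

theorem blockIndex_injective {N r : ℕ} :
    Function.Injective fun p : Fin 2 × Fin N => (blockIndex p.1 p.2 : Fin (N + N + r)) := by
  rintro ⟨s, i⟩ ⟨s', i'⟩ h
  have h1 := i.2
  have h2 := i'.2
  simp only [blockIndex, Fin.mk.injEq] at h
  fin_cases s <;> fin_cases s' <;> simp at h ⊢ <;> omega

/-- The code that sends `E₀` during the first block, then `E₁`, which may depend on the outputs of
the first block, and finally zeros. -/
noncomputable def twoBlockCode {N : ℕ} (r : ℕ) {M : Fin 2 → ℕ}
    (E₀ : (k : Fin 2) → Fin (M k) → Fin N → ℂ)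
    (E₁ : (k : Fin 2) → Fin (M k) → (Fin N → ℂ) → Fin N → ℂ)
    (D : (k : Fin 2) → (Fin N → ℂ) × (Fin N → ℂ) → Fin (M k))
    (hE₁ : ∀ k m, Measurable (E₁ k m)) (hD : ∀ k, Measurable (D k)) : Code (N + N + r) M where
  enc k i m past :=
    if h : i.val < N then E₀ k m ⟨i, h⟩
    else if h' : i.val < N + N then
      E₁ k m (fun j => past ⟨j, by have := j.2; omega⟩) ⟨i - N, by omega⟩
    else 0
  dec k y := D k (fun j => y (blockIndex 0 j), fun j => y (blockIndex 1 j))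
  measurable_enc k i m := by
    split_ifs with h h'
    · exact measurable_const
    · exact (measurable_pi_apply _).comp ((hE₁ k m).comp (by fun_prop))
    · exact measurable_const
  measurable_dec k := (hD k).comp (by fun_prop)

section TwoBlock

variable {N r : ℕ} {M : Fin 2 → ℕ} {E₀ : (k : Fin 2) → Fin (M k) → Fin N → ℂ}
  {E₁ : (k : Fin 2) → Fin (M k) → (Fin N → ℂ) → Fin N → ℂ}
  {D : (k : Fin 2) → (Fin N → ℂ) × (Fin N → ℂ) → Fin (M k)}
  {hE₁ : ∀ k m, Measurable (E₁ k m)} {hD : ∀ k, Measurable (D k)}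

theorem input_twoBlockCode_zero (gd gc : ℂ) (w : (k : Fin 2) → Fin (M k))
    (z : Fin 2 → Fin (N + N + r) → ℂ) (k : Fin 2) (i : Fin N) :
    (twoBlockCode r E₀ E₁ D hE₁ hD).input gd gc w z k (blockIndex 0 i) = E₀ k (w k) i := by
  simp [Code.input, twoBlockCode, blockIndex]

theorem input_twoBlockCode_one (gd gc : ℂ) (w : (k : Fin 2) → Fin (M k))
    (z : Fin 2 → Fin (N + N + r) → ℂ) (k : Fin 2) (i : Fin N) :
    (twoBlockCode r E₀ E₁ D hE₁ hD).input gd gc w z k (blockIndex 1 i) =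
      E₁ k (w k) (fun j => (twoBlockCode r E₀ E₁ D hE₁ hD).output gd gc w z k (blockIndex 0 j))
        i := by
  have h := i.2
  have h1 : ¬ (N + i.val < N) := by omega
  simp only [Code.input, twoBlockCode, blockIndex, Fin.val_one, one_mul, h1, dif_neg,
    not_false_eq_true, Nat.add_lt_add_iff_left, h, dif_pos, Fin.val_zero, zero_mul, zero_add,
    Nat.add_sub_cancel_left]

theorem input_twoBlockCode_tail (gd gc : ℂ) (w : (k : Fin 2) → Fin (M k))
    (z : Fin 2 → Fin (N + N + r) → ℂ) (k : Fin 2) (i : Fin r) :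
    (twoBlockCode r E₀ E₁ D hE₁ hD).input gd gc w z k (Fin.natAdd (N + N) i) = 0 := by
  have h1 : ¬ (N + N + i.val < N) := by omega
  have h2 : ¬ (N + N + i.val < N + N) := by omega
  simp only [Code.input, twoBlockCode, Fin.val_natAdd, h1, h2, dif_neg, not_false_eq_true]

theorem powerConstraint_twoBlockCode (gd gc : ℂ) (h₀ : ∀ k m, energy (E₀ k m) ≤ N)
    (h₁ : ∀ k m y, energy (E₁ k m y) ≤ N) :
    (twoBlockCode r E₀ E₁ D hE₁ hD).PowerConstraint gd gc := by
  intro w k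
  refine (lintegral_mono (g := fun _ => ((N + N + r : ℕ) : ENNReal)) fun z => ?_).trans (by simp)
  set x := (twoBlockCode r E₀ E₁ D hE₁ hD).input gd gc w z k with hx
  have e0 : ∀ i : Fin N, Fin.castAdd r (Fin.castAdd N i) = blockIndex 0 i := fun i => by
    ext; simp [blockIndex]
  have e1 : ∀ i : Fin N, Fin.castAdd r (Fin.natAdd N i) = blockIndex 1 i := fun i => by
    ext; simp [blockIndex, add_comm]
  have hsum : ∑ i, ‖x i‖ ^ 2 ≤ ((N + N + r : ℕ) : ℝ) := by
    rw [Fin.sum_univ_add, Fin.sum_univ_add]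
    simp only [e0, e1, hx, input_twoBlockCode_zero, input_twoBlockCode_one,
      input_twoBlockCode_tail]
    have := h₀ k (w k)
    have := h₁ k (w k)
      (fun j => (twoBlockCode r E₀ E₁ D hE₁ hD).output gd gc w z k (blockIndex 0 j))
    simp only [energy] at *
    push_cast
    simp only [norm_zero, ne_eq, OfNat.ofNat_ne_zero, not_false_eq_true, zero_pow,
      Finset.sum_const_zero]
    have : (0 : ℝ) ≤ r := by positivity
    linarith
  have hconv : ∑ i, ‖x i‖ₑ ^ 2 = ENNReal.ofReal (∑ i, ‖x i‖ ^ 2) := by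
    rw [ENNReal.ofReal_sum_of_nonneg fun _ _ => by positivity]
    refine Finset.sum_congr rfl fun i _ => ?_
    rw [ENNReal.ofReal_pow (norm_nonneg _), ofReal_norm]
  rw [hconv]
  refine (ENNReal.ofReal_le_ofReal hsum).trans ?_
  rw [ENNReal.ofReal_natCast]

end TwoBlock

/-- The zero block replaces blocks of energy above `N`. -/
noncomputable def clip {N : ℕ} (v : Fin N → ℂ) : Fin N → ℂ :=
  open Classical in if energy v ≤ N then v else 0

theorem energy_clip_le {N : ℕ} (v : Fin N → ℂ) : energy (clip v) ≤ N := by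
  unfold clip
  split_ifs with h
  · exact h
  · simp [energy]

theorem clip_of_le {N : ℕ} {v : Fin N → ℂ} (h : energy v ≤ N) : clip v = v := if_pos h

theorem energy_star {N : ℕ} (v : Fin N → ℂ) : energy (star v) = energy v := by
  simp [energy]

/-! ### Noise of the two blocks -/

/-- The noise of the first block and the conjugated noise of the second block. -/
noncomputable def noiseBlocks {N r : ℕ} (z : Fin 2 → Fin (N + N + r) → ℂ) :
    Fin 2 × Fin 2 → Fin N → ℂ := fun p =>
  if p.2 = 0 then fun i => z p.1 (blockIndex p.2 i)
  else fun i => starRingEnd ℂ (z p.1 (blockIndex p.2 i))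

/-- `CN(0,1)` is invariant under conjugation. Conjugating the second block makes the signals that
the receivers combine complex linear in the blocks. -/
theorem measurePreserving_noiseBlocks (N r : ℕ) :
    MeasurePreserving (noiseBlocks (N := N) (r := r)) (noise (N + N + r))
      (streams (Fin 2 × Fin 2) N) := by
  have h1 := measurePreserving_uncurry (ι := Fin 2) (κ := Fin (N + N + r)) complexGaussian
  have h2 := measurePreserving_precomp complexGaussian
    (f := fun p : (Fin 2 × Fin 2) × Fin N =>
      (p.1.1, (blockIndex p.1.2 p.2 : Fin (N + N + r)))) (by
    rintro ⟨⟨k, s⟩, i⟩ ⟨⟨k', s'⟩, i'⟩ h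
    simp only [Prod.mk.injEq] at h
    have := blockIndex_injective (a₁ := (s, i)) (a₂ := (s', i')) h.2
    simp only [Prod.mk.injEq] at this
    simp [h.1, this])
  have h3 := measurePreserving_curry (ι := Fin 2 × Fin 2) (κ := Fin N) complexGaussian
  have h4 : MeasurePreserving (fun (x : Fin 2 × Fin 2 → Fin N → ℂ) (p : Fin 2 × Fin 2) =>
      (if p.2 = 0 then id else fun (v : Fin N → ℂ) i => starRingEnd ℂ (v i) :
        (Fin N → ℂ) → Fin N → ℂ) (x p)) (streams (Fin 2 × Fin 2) N)
      (streams (Fin 2 × Fin 2) N) := by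
    refine measurePreserving_pi _ _ (f := fun p : Fin 2 × Fin 2 =>
      (if p.2 = 0 then id else fun (v : Fin N → ℂ) i => starRingEnd ℂ (v i) :
        (Fin N → ℂ) → Fin N → ℂ)) fun p => ?_
    split_ifs
    · exact MeasurePreserving.id _
    · exact measurePreserving_pi _ _ fun _ => measurePreserving_conj
  have h := h4.comp (h3.comp (h2.comp h1))
  convert! h using 1
  ext z p i
  simp only [noiseBlocks, Function.comp_apply]
  split_ifs <;> rfl

theorem measurePreserving_sumElim_noiseBlocks (S : Type*) [Fintype S] (N r : ℕ) :
    MeasurePreserving (fun p : (S → Fin N → ℂ) × (Fin 2 → Fin (N + N + r) → ℂ) =>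
      (Sum.elim p.1 (noiseBlocks p.2) : S ⊕ (Fin 2 × Fin 2) → Fin N → ℂ))
      ((streams S N).prod (noise (N + N + r))) (streams (S ⊕ (Fin 2 × Fin 2)) N) := by
  have h1 := measurePreserving_sumPiEquivProdPi_symm
    (fun _ : S ⊕ (Fin 2 × Fin 2) => Measure.pi fun _ : Fin N => complexGaussian)
  have h := h1.comp ((MeasurePreserving.id (streams S N)).prod (measurePreserving_noiseBlocks N r))
  convert! h using 1

/-! ### Superposition coding with relaying by the Alamouti code -/

/-- The blocks that make up the signals of one codeword pair: for each user, its common codeword,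
its private codewords of the first and of the second block, and its noise in the two blocks. -/
abbrev Role : Type := Fin 2 × (Fin 3 ⊕ Fin 2)

/-- Indices of all codewords and noise blocks, where each user has a book of size `L 0` of common
codewords, and books of sizes `L 1` and `L 2` of private codewords for the two blocks. -/
abbrev StreamIndex (L : Fin 3 → ℕ) : Type := (Fin 2 × Σ t : Fin 3, Fin (L t)) ⊕ (Fin 2 × Fin 2)

/-- The block that plays a given role when the messages are `w`. -/
def locate {L : Fin 3 → ℕ} (w : (k : Fin 2) → (t : Fin 3) → Fin (L t)) : Role → StreamIndex L
  | (k, .inl t) => .inl (k, ⟨t, w k t⟩)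
  | (k, .inr s) => .inr (k, s)

theorem locate_injective {L : Fin 3 → ℕ} (w : (k : Fin 2) → (t : Fin 3) → Fin (L t)) :
    Function.Injective (locate w) := by
  rintro ⟨k, t | s⟩ ⟨k', t' | s'⟩ h
  · simp only [locate, Sum.inl.injEq, Prod.mk.injEq, Sigma.mk.injEq] at h
    simp [h.1, h.2.1]
  · simp [locate] at h
  · simp [locate] at h
  · simpa [locate] using h

/-- Signs of the relayed codewords in the Alamouti code. -/
def alamoutiSign : Fin 2 → ℂ := ![1, -1]

/-- Coefficients `a` and `b` at the codewords and at the noise of user `k`, and `a'` at the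
codewords of the other user. -/
def coefs (k : Fin 2) (a : Fin 3 → ℂ) (b : Fin 2 → ℂ) (a' : Fin 3 → ℂ) : Role → ℂ
  | (l, .inl t) => if l = k then a t else a' t
  | (l, .inr s) => if l = k then b s else 0

theorem comb_coefs {N : ℕ} (k : Fin 2) (a : Fin 3 → ℂ) (b : Fin 2 → ℂ) (a' : Fin 3 → ℂ)
    (y : Role → Fin N → ℂ) (i : Fin N) :
    comb (coefs k a b a') y i = ∑ t, a t * y (k, .inl t) i + ∑ s, b s * y (k, .inr s) i
      + ∑ t, a' t * y (1 - k, .inl t) i := by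
  fin_cases k <;>
  simp [comb, coefs, Fintype.sum_prod_type, Fintype.sum_sum_type, Fin.sum_univ_two]
  ring

theorem sum_norm_sq_coefs (k : Fin 2) (a : Fin 3 → ℂ) (b : Fin 2 → ℂ) (a' : Fin 3 → ℂ) :
    ∑ j, ‖coefs k a b a' j‖ ^ 2 = ∑ t, ‖a t‖ ^ 2 + ∑ s, ‖b s‖ ^ 2 + ∑ t, ‖a' t‖ ^ 2 := by
  fin_cases k <;>
  simp [coefs, Fintype.sum_prod_type, Fintype.sum_sum_type, Fin.sum_univ_two]
  ring

section Scheme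

variable (g h A B : ℂ)

/-- Signals from which user `k` decodes: at its transmitter the common message of the other user
(step `0`); at its receiver its own common message, that of the other user, and its private messages
of the first and of the second block (steps `1` to `4`). -/
def stepCoef : Fin 2 × Fin 5 → Role → ℂ := fun d =>
  let k := d.1
  let g' := starRingEnd ℂ g
  let h' := starRingEnd ℂ h
  let s := alamoutiSign d.1
  coefs k
    (![![0, 0, 0],
      ![(g' * g + h * h') * A, g' * g * B, -s * h * g' * B],
      ![0, h' * g * B, s * g * g' * B],
      ![0, g * B, 0],
      ![0, 0, g' * B]] d.2)
    (![![1, 0], ![g', -s * h], ![h', s * g], ![1, 0], ![0, 1]] d.2)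
    (![![h * A, h * B, 0],
      ![0, g' * h * B, -s * h * h' * B],
      ![(h' * h + g * g') * A, h' * h * B, s * g * h' * B],
      ![0, h * B, 0],
      ![0, 0, h' * B]] d.2)

/-- The user and the kind of the codeword decoded in each step. -/
def stepTarget : Fin 2 × Fin 5 → Fin 2 × Fin 3 := fun d =>
  ![(1 - d.1, 0), (d.1, 0), (1 - d.1, 0), (d.1, 1), (d.1, 2)] d.2

/-- The role of the codeword decoded in each step. -/
def stepRole (d : Fin 2 × Fin 5) : Role := ((stepTarget d).1, .inl (stepTarget d).2)

/-- The coefficient of the codeword decoded in each step. -/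
def stepGain (d : Fin 2 × Fin 5) : ℂ := stepCoef g h A B d (stepRole d)

/-- The signals sent by user `p.1` in block `p.2`, conjugated in the second block. -/
def sentCoef : Fin 2 × Fin 2 → Role → ℂ := fun p =>
  coefs p.1 (![![A, B, 0], ![0, 0, B]] p.2) 0 (![0, ![alamoutiSign p.1 * A, 0, 0]] p.2)

/-- The blocks for which some decoding step fails or some signal has too much power. -/
def badEvent {N : ℕ} {L : Fin 3 → ℕ} (T : Fin 2 × Fin 5 → ℝ)
    (w : (k : Fin 2) → (t : Fin 3) → Fin (L t)) : Set (StreamIndex L → Fin N → ℂ) :=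
  (⋃ d, {x | DecodingFails (stepGain g h A B d) (T d)
      (fun m => x (.inl ((stepTarget d).1, ⟨(stepTarget d).2, m⟩)))
      (w (stepTarget d).1 (stepTarget d).2)
      (comb (stepCoef g h A B d) fun j => x (locate w j))}) ∪
  ⋃ p, {x | N < energy (comb (sentCoef A B p) fun j => x (locate w j))}

theorem measurableSet_badEvent {N : ℕ} {L : Fin 3 → ℕ} (T : Fin 2 × Fin 5 → ℝ)
    (w : (k : Fin 2) → (t : Fin 3) → Fin (L t)) :
    MeasurableSet (badEvent (N := N) g h A B T w) := by
  have hm : ∀ c : Role → ℂ, Measurable fun x : StreamIndex L → Fin N → ℂ =>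
      comb c fun j => x (locate w j) := fun c => (measurable_comb c).comp (by fun_prop)
  refine (MeasurableSet.iUnion fun d => ?_).union (MeasurableSet.iUnion fun p => ?_)
  · exact measurableSet_decodingFails _ _ _ (by fun_prop) (hm _)
  · exact measurableSet_lt measurable_const (measurable_energy.comp (hm _))

/-- Sizes of the codebooks of rates `ρ`. -/
noncomputable def bookSize (N : ℕ) (ρ : Fin 3 → ℝ) (t : Fin 3) : ℕ := ⌈(2 : ℝ) ^ (N * ρ t)⌉₊

theorem bookSize_pos (N : ℕ) (ρ : Fin 3 → ℝ) (t : Fin 3) : 0 < bookSize N ρ t :=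
  Nat.ceil_pos.2 (by positivity)

theorem eventually_badEvent_le (hAB : ‖A‖ ^ 2 + ‖B‖ ^ 2 < 1) {ρ : Fin 3 → ℝ}
    (hρ : ∀ d, ρ (stepTarget d).2 = 0 ∨ 0 < ρ (stepTarget d).2 ∧
      ρ (stepTarget d).2 < Real.logb 2 (1 + ‖stepGain g h A B d‖ ^ 2 /
        ∑ j, ‖Function.update (stepCoef g h A B d) (stepRole d) 0 j‖ ^ 2)) :
    ∃ T : Fin 2 × Fin 5 → ℝ, ∀ ε : ℝ, 0 < ε → ∀ᶠ N : ℕ in atTop,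
      ∀ w : (k : Fin 2) → (t : Fin 3) → Fin (bookSize N ρ t),
        (streams (StreamIndex (bookSize N ρ)) N).real (badEvent g h A B T w) ≤ ε := by
  choose T hT using fun d => eventually_decodingFails_le (stepCoef g h A B d) (stepRole d) (hρ d)
  refine ⟨T, fun ε hε => ?_⟩
  -- Ten decoding steps and four power events.
  have hε' : 0 < ε / 14 := by positivity
  have hsent : ∀ p, ∑ j, ‖sentCoef A B p j‖ ^ 2 < 1 := by
    rintro ⟨k, s⟩
    rw [sentCoef, sum_norm_sq_coefs]
    fin_cases k <;> fin_cases s <;>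
      simp [Fin.sum_univ_three, alamoutiSign] <;> linarith
  filter_upwards [eventually_all.2 fun d => hT d _ hε',
    eventually_all.2 fun p => eventually_energy_gt_le (sentCoef A B p) (hsent p) hε'] with N h1 h2
  intro w
  refine (measureReal_union_le _ _).trans ((add_le_add (measureReal_iUnion_fintype_le _)
    (measureReal_iUnion_fintype_le _)).trans ((add_le_add
    (Finset.sum_le_card_nsmul _ _ (ε / 14) fun d _ => ?_)
    (Finset.sum_le_card_nsmul _ _ (ε / 14) fun p _ => ?_)).trans ?_))
  · refine h1 d _ _ (locate w)
      (fun m => .inl ((stepTarget d).1, ⟨(stepTarget d).2, m⟩)) _ rfl (locate_injective w) rfl ?_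
    -- The transmitted signals use only the codeword `w` of each book, so a false codeword is not
    -- among their blocks.
    rintro m hm ⟨k, t | s⟩ hj
    · simp only [locate, Sum.inl.injEq, Prod.mk.injEq] at hj
      obtain ⟨rfl, hj⟩ := hj
      obtain ⟨rfl, hj⟩ := Sigma.mk.inj_iff.1 hj
      exact hm (eq_of_heq hj).symm
    · simp [locate] at hj
  · exact h2 p _ (locate w) (locate_injective w)
  · simp only [Finset.card_univ, Fintype.card_prod, Fintype.card_fin, nsmul_eq_mul]
    push_cast
    linarith

end Scheme

/-! ### Encoders and decoders for given codebooks. -/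

section Codec

variable (g h A B : ℂ) (T : Fin 2 × Fin 5 → ℝ) {N : ℕ} {L : Fin 3 → ℕ}
  (cb : Fin 2 × (Σ t : Fin 3, Fin (L t)) → Fin N → ℂ)

/-- Signal of user `k` in the first block, before clipping. -/
noncomputable def firstSignal (k : Fin 2) (m : (t : Fin 3) → Fin (L t)) : Fin N → ℂ :=
  A • cb (k, ⟨0, m 0⟩) + B • cb (k, ⟨1, m 1⟩)

variable [∀ t, Nonempty (Fin (L t))]

/-- Estimate by transmitter `k` of the other user's common message after the first block. -/
noncomputable def relayEstimate (k : Fin 2) (m : (t : Fin 3) → Fin (L t)) (y : Fin N → ℂ) :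
    Fin (L 0) :=
  thresholdDecode (stepGain g h A B (k, 0)) (T (k, 0)) (fun c => cb (1 - k, ⟨0, c⟩))
    (y - g • firstSignal A B cb k m)

/-- Signal of user `k` in the second block, before clipping. -/
noncomputable def secondSignal (k : Fin 2) (m : (t : Fin 3) → Fin (L t)) (y : Fin N → ℂ) :
    Fin N → ℂ :=
  star ((alamoutiSign k * A) • cb (1 - k, ⟨0, relayEstimate g h A B T cb k m y⟩)
    + B • cb (k, ⟨2, m 2⟩))

/-- Estimate of the own common message at receiver `k`. -/
noncomputable def ownCommon (k : Fin 2) (y : (Fin N → ℂ) × (Fin N → ℂ)) : Fin (L 0) :=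
  thresholdDecode (stepGain g h A B (k, 1)) (T (k, 1)) (fun c => cb (k, ⟨0, c⟩))
    (starRingEnd ℂ g • y.1 - (alamoutiSign k * h) • star y.2)

/-- Estimate of the other user's common message at receiver `k`. -/
noncomputable def otherCommon (k : Fin 2) (y : (Fin N → ℂ) × (Fin N → ℂ)) : Fin (L 0) :=
  thresholdDecode (stepGain g h A B (k, 2)) (T (k, 2)) (fun c => cb (1 - k, ⟨0, c⟩))
    (starRingEnd ℂ h • y.1 + (alamoutiSign k * g) • star y.2)

/-- The first block at receiver `k` after subtracting the estimated common codewords. -/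
noncomputable def firstResidual (k : Fin 2) (y : (Fin N → ℂ) × (Fin N → ℂ)) : Fin N → ℂ :=
  y.1 - (g * A) • cb (k, ⟨0, ownCommon g h A B T cb k y⟩)
    - (h * A) • cb (1 - k, ⟨0, otherCommon g h A B T cb k y⟩)

/-- The conjugated second block at receiver `k` after subtracting the estimated common
codewords. -/
noncomputable def secondResidual (k : Fin 2) (y : (Fin N → ℂ) × (Fin N → ℂ)) : Fin N → ℂ :=
  star y.2 + (alamoutiSign k * starRingEnd ℂ h * A) • cb (k, ⟨0, ownCommon g h A B T cb k y⟩)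
    - (alamoutiSign k * starRingEnd ℂ g * A) • cb (1 - k, ⟨0, otherCommon g h A B T cb k y⟩)

/-- The estimate of the message of user `k` at its receiver. -/
noncomputable def receiver (k : Fin 2) (y : (Fin N → ℂ) × (Fin N → ℂ)) :
    (t : Fin 3) → Fin (L t)
  | 0 => ownCommon g h A B T cb k y
  | 1 => thresholdDecode (stepGain g h A B (k, 3)) (T (k, 3)) (fun c => cb (k, ⟨1, c⟩))
      (firstResidual g h A B T cb k y)
  | 2 => thresholdDecode (stepGain g h A B (k, 4)) (T (k, 4)) (fun c => cb (k, ⟨2, c⟩))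
      (secondResidual g h A B T cb k y)

theorem measurable_secondSignal (k : Fin 2) (m : (t : Fin 3) → Fin (L t)) :
    Measurable (secondSignal g h A B T cb k m) := by
  have h1 : Measurable (relayEstimate g h A B T cb k m) :=
    (measurable_thresholdDecode _ _ _).comp (measurable_id.sub_const _)
  exact (measurable_of_finite fun c => star ((alamoutiSign k * A) • cb (1 - k, ⟨0, c⟩)
    + B • cb (k, ⟨2, m 2⟩))).comp h1

theorem measurable_receiver (k : Fin 2) : Measurable (receiver g h A B T cb k) := by
  have hstar : Measurable fun y : (Fin N → ℂ) × (Fin N → ℂ) => star y.2 :=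
    measurable_pi_iff.2 fun i => by
      simp only [Pi.star_apply]
      exact Complex.continuous_conj.measurable.comp
        ((measurable_pi_apply i).comp measurable_snd)
  have h1 : Measurable (ownCommon g h A B T cb k) :=
    (measurable_thresholdDecode _ _ _).comp (by fun_prop)
  have h2 : Measurable (otherCommon g h A B T cb k) :=
    (measurable_thresholdDecode _ _ _).comp (by fun_prop)
  have hb : ∀ (l : Fin 2) (a : ℂ), Measurable fun c : Fin (L 0) => a • cb (l, ⟨0, c⟩) :=
    fun l a => measurable_of_finite _
  refine measurable_pi_iff.2 fun t => ?_
  fin_cases t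
  · exact h1
  · exact (measurable_thresholdDecode _ _ _).comp
      ((measurable_fst.sub ((hb _ _).comp h1)).sub ((hb _ _).comp h2))
  · exact (measurable_thresholdDecode _ _ _).comp
      ((hstar.add ((hb _ _).comp h1)).sub ((hb _ _).comp h2))

/-- The code with codebooks `cb`. -/
noncomputable def superpositionCode (r : ℕ) : Code (N + N + r) (fun _ => ∏ t, L t) :=
  twoBlockCode r (fun k m => clip (firstSignal A B cb k (finPiFinEquiv.symm m)))
    (fun k m y => clip (secondSignal g h A B T cb k (finPiFinEquiv.symm m) y))
    (fun k y => finPiFinEquiv (receiver g h A B T cb k y))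
    (fun k m => by
      have : Measurable (clip (N := N)) :=
        Measurable.ite (measurableSet_le measurable_energy measurable_const) measurable_id
          measurable_const
      exact this.comp (measurable_secondSignal g h A B T cb k _))
    (fun k => (measurable_of_finite _).comp (measurable_receiver g h A B T cb k))

theorem powerConstraint_superpositionCode (r : ℕ) :
    (superpositionCode g h A B T cb r).PowerConstraint g h :=
  powerConstraint_twoBlockCode _ _ (fun _ _ => energy_clip_le _) fun _ _ _ => energy_clip_le _

/-- Outside the bad event no signal is clipped, and each step observes exactly its combination
`stepCoef`. The relays' success fixes the second block, and the decoding of both common messages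
leaves exactly the residuals that the private steps expect. -/
theorem superpositionCode_correct {r : ℕ} (w : Fin 2 → Fin (∏ t, L t))
    (z : Fin 2 → Fin (N + N + r) → ℂ)
    (hgood : Sum.elim cb (noiseBlocks z) ∉
      badEvent g h A B T fun k => finPiFinEquiv.symm (w k)) (k : Fin 2) :
    (superpositionCode g h A B T cb r).dec k
      ((superpositionCode g h A B T cb r).output g h w z k) = w k := by
  set C := superpositionCode g h A B T cb r with hC
  set m : (k : Fin 2) → (t : Fin 3) → Fin (L t) := fun k => finPiFinEquiv.symm (w k) with hm
  set x : Role → Fin N → ℂ := fun j => Sum.elim cb (noiseBlocks z) (locate m j) with hx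
  have hcode : ∀ l t, cb (l, ⟨t, m l t⟩) = x (l, .inl t) := fun _ _ => rfl
  simp only [badEvent, Set.mem_union, Set.mem_iUnion, not_or, not_exists, Set.mem_ofPred_eq,
    not_lt] at hgood
  obtain ⟨hdec, hpow⟩ := hgood
  have hsign : ∀ k, alamoutiSign (1 - k) = -alamoutiSign k := fun k => by
    fin_cases k <;> simp [alamoutiSign]
  have hsq : ∀ k, alamoutiSign k * alamoutiSign k = 1 := fun k => by
    fin_cases k <;> simp [alamoutiSign]
  have hkk : ∀ k : Fin 2, 1 - (1 - k) = k := fun k => by fin_cases k <;> rfl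
  set Y₀ : Fin 2 → Fin N → ℂ := fun k i => C.output g h w z k (blockIndex 0 i) with hY₀
  set Y₁ : Fin 2 → Fin N → ℂ := fun k i => C.output g h w z k (blockIndex 1 i) with hY₁
  have hX₀ : ∀ k, firstSignal A B cb k (m k) = comb (sentCoef A B (k, 0)) x := fun k => by
    ext i
    simp [sentCoef, comb_coefs, Fin.sum_univ_three, firstSignal, hcode]
  have hclip₀ : ∀ k, clip (firstSignal A B cb k (m k)) = firstSignal A B cb k (m k) := fun k =>
    clip_of_le (by rw [hX₀]; exact hpow (k, 0))
  have hY₀' : ∀ k i, Y₀ k i = g * (A * x (k, .inl 0) i + B * x (k, .inl 1) i)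
      + h * (A * x (1 - k, .inl 0) i + B * x (1 - k, .inl 1) i) + x (k, .inr 0) i := fun k i => by
    have hz : z k (blockIndex 0 i) = x (k, .inr 0) i := rfl
    simp only [hY₀]
    rw [Code.output_eq, hC, superpositionCode, input_twoBlockCode_zero, input_twoBlockCode_zero,
      hz]
    change g * clip (firstSignal A B cb k (m k)) i
      + h * clip (firstSignal A B cb (1 - k) (m (1 - k))) i + _ = _
    rw [hclip₀, hclip₀]
    rfl
  have hrelay : ∀ k, relayEstimate g h A B T cb k (m k) (Y₀ k) = m (1 - k) 0 := fun k => by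
    have e : Y₀ k - g • firstSignal A B cb k (m k) = comb (stepCoef g h A B (k, 0)) x := by
      ext i
      simp [hY₀', firstSignal, hcode, stepCoef, comb_coefs, Fin.sum_univ_three]
      ring
    rw [relayEstimate, e]
    exact thresholdDecode_eq (hdec (k, 0))
  have hX₁ : ∀ k, star (secondSignal g h A B T cb k (m k) (Y₀ k))
      = comb (sentCoef A B (k, 1)) x := fun k => by
    rw [secondSignal, hrelay, star_star]
    ext i
    simp [sentCoef, comb_coefs, Fin.sum_univ_three, hcode]
    ring
  have hclip₁ : ∀ k, clip (secondSignal g h A B T cb k (m k) (Y₀ k))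
      = star (comb (sentCoef A B (k, 1)) x) := fun k => by
    rw [clip_of_le, ← hX₁, star_star]
    rw [← energy_star, hX₁]
    exact hpow (k, 1)
  have hY₁' : ∀ k i, starRingEnd ℂ (Y₁ k i) =
      starRingEnd ℂ g * (alamoutiSign k * A * x (1 - k, .inl 0) i + B * x (k, .inl 2) i)
      + starRingEnd ℂ h * (-alamoutiSign k * A * x (k, .inl 0) i + B * x (1 - k, .inl 2) i)
      + x (k, .inr 1) i := fun k i => by
    have hz : starRingEnd ℂ (z k (blockIndex 1 i)) = x (k, .inr 1) i := rfl
    simp only [hY₁]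
    rw [Code.output_eq, hC, superpositionCode, input_twoBlockCode_one, input_twoBlockCode_one,
      map_add, map_add, map_mul, map_mul, hz]
    change _ * starRingEnd ℂ (clip (secondSignal g h A B T cb k (m k) (Y₀ k)) i)
      + _ * starRingEnd ℂ (clip (secondSignal g h A B T cb (1 - k) (m (1 - k)) (Y₀ (1 - k))) i)
      + _ = _
    rw [hclip₁, hclip₁]
    simp [sentCoef, comb_coefs, Fin.sum_univ_three, hsign, hkk]
    ring
  have hown : ownCommon g h A B T cb k (Y₀ k, Y₁ k) = m k 0 := by
    have e : starRingEnd ℂ g • Y₀ k - (alamoutiSign k * h) • star (Y₁ k) = comb (stepCoef g h A B (k, 1)) x := by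
      ext i
      simp [hY₀', hY₁', stepCoef, comb_coefs, Fin.sum_univ_three]
      -- Alamouti cancellation: as the sign squares to one, the two copies of the own common
      -- codeword add up and those of the other cancel.
      linear_combination (A * h * starRingEnd ℂ h * x (k, .inl 0) i
        - A * h * starRingEnd ℂ g * x (1 - k, .inl 0) i) * hsq k
    rw [ownCommon, e]
    exact thresholdDecode_eq (hdec (k, 1))
  have hother : otherCommon g h A B T cb k (Y₀ k, Y₁ k) = m (1 - k) 0 := by
    have e : starRingEnd ℂ h • Y₀ k + (alamoutiSign k * g) • star (Y₁ k) = comb (stepCoef g h A B (k, 2)) x := by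
      ext i
      simp [hY₀', hY₁', stepCoef, comb_coefs, Fin.sum_univ_three]
      linear_combination (A * g * starRingEnd ℂ g * x (1 - k, .inl 0) i
        - A * g * starRingEnd ℂ h * x (k, .inl 0) i) * hsq k
    rw [otherCommon, e]
    exact thresholdDecode_eq (hdec (k, 2))
  have hfirst : receiver g h A B T cb k (Y₀ k, Y₁ k) 1 = m k 1 := by
    have e : firstResidual g h A B T cb k (Y₀ k, Y₁ k) = comb (stepCoef g h A B (k, 3)) x := by
      ext i
      simp [firstResidual, hown, hother, hcode, hY₀', stepCoef, comb_coefs, Fin.sum_univ_three]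
      ring
    rw [receiver, e]
    exact thresholdDecode_eq (hdec (k, 3))
  have hsecond : receiver g h A B T cb k (Y₀ k, Y₁ k) 2 = m k 2 := by
    have e : secondResidual g h A B T cb k (Y₀ k, Y₁ k) = comb (stepCoef g h A B (k, 4)) x := by
      ext i
      simp [secondResidual, hown, hother, hcode, hY₁', stepCoef, comb_coefs, Fin.sum_univ_three]
      ring
    rw [receiver, e]
    exact thresholdDecode_eq (hdec (k, 4))
  have hrec : receiver g h A B T cb k (Y₀ k, Y₁ k) = m k := by
    ext t : 1
    fin_cases t
    · exact hown
    · exact hfirst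
    · exact hsecond
  change finPiFinEquiv (receiver g h A B T cb k (Y₀ k, Y₁ k)) = w k
  rw [hrec]
  exact finPiFinEquiv.apply_symm_apply _

end Codec

/-! ### Random codebooks -/

/-- Random coding: codebook and noise together have the law `streams`, so by Fubini the error
averaged over codebooks is at most `ε`, and some codebook is no worse than the average. -/
theorem exists_codebook (g h A B : ℂ) (T : Fin 2 × Fin 5 → ℝ) {N r : ℕ} {L : Fin 3 → ℕ}
    [∀ t, Nonempty (Fin (L t))] {ε : ℝ}
    (hbad : ∀ w : (k : Fin 2) → (t : Fin 3) → Fin (L t),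
      (streams (StreamIndex L) N).real (badEvent g h A B T w) ≤ ε) :
    ∃ cb : Fin 2 × (Σ t : Fin 3, Fin (L t)) → Fin N → ℂ,
      (superpositionCode g h A B T cb r).errorProb g h ≤ ε := by
  set Φ := fun p : (Fin 2 × (Σ t : Fin 3, Fin (L t)) → Fin N → ℂ) ×
      (Fin 2 → Fin (N + N + r) → ℂ) =>
    (Sum.elim p.1 (noiseBlocks p.2) : StreamIndex L → Fin N → ℂ)
  have hΦ := measurePreserving_sumElim_noiseBlocks (Fin 2 × (Σ t : Fin 3, Fin (L t))) N r
  let M : ℕ := ∏ t, L t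
  have hM : 0 < M := Finset.prod_pos fun t _ => Fin.pos_iff_nonempty.2 inferInstance
  let bad : (Fin 2 → Fin M) → Set (StreamIndex L → Fin N → ℂ) := fun w =>
    badEvent g h A B T fun k => finPiFinEquiv.symm (w k)
  have hmeas : ∀ w, MeasurableSet (Φ ⁻¹' bad w) := fun w =>
    hΦ.measurable (measurableSet_badEvent g h A B T _)
  let F : (Fin 2 → Fin M) → (Fin 2 × (Σ t : Fin 3, Fin (L t)) → Fin N → ℂ) → ℝ := fun w cb =>
    (noise (N + N + r)).real (Prod.mk cb ⁻¹' (Φ ⁻¹' bad w))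
  have hFint : ∀ w, Integrable (F w) (streams _ N) := fun w =>
    Integrable.of_bound (C := 1)
      (measurable_measure_prodMk_left (hmeas w)).ennreal_toReal.aestronglyMeasurable
      (Eventually.of_forall fun cb => by
        rw [Real.norm_of_nonneg measureReal_nonneg]; exact measureReal_le_one)
  have hF : ∀ w, ∫ cb, F w cb ∂(streams _ N) ≤ ε := fun w => by
    have h1 : ∫ cb, F w cb ∂(streams _ N)
        = ((streams _ N).prod (noise (N + N + r))).real (Φ ⁻¹' bad w) := by
      rw [measureReal_def, Measure.prod_apply (hmeas w)]
      exact integral_toReal (measurable_measure_prodMk_left (hmeas w)).aemeasurable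
        (Eventually.of_forall fun _ => measure_lt_top _ _)
    rw [h1, measureReal_def,
      hΦ.measure_preimage (measurableSet_badEvent g h A B T _).nullMeasurableSet]
    exact hbad _
  obtain ⟨cb, hcb⟩ := exists_le_integral (μ := streams (Fin 2 × (Σ t : Fin 3, Fin (L t))) N)
    (f := fun cb => ∑ w, F w cb) (integrable_finsetSum _ fun w _ => hFint w)
  refine ⟨cb, ?_⟩
  rw [integral_finsetSum _ fun w _ => hFint w] at hcb
  have hMpos : (0 : ℝ) < M := by exact_mod_cast hM
  rw [Code.errorProb, div_le_iff₀ (mul_pos hMpos hMpos)]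
  calc _ ≤ ∑ w, F w cb := Finset.sum_le_sum fun w _ => measureReal_mono fun z hz => by
          by_contra hgood
          obtain ⟨k, hk⟩ := hz
          exact hk (superpositionCode_correct g h A B T cb w z hgood k)
    _ ≤ ∑ w : Fin 2 → Fin M, ε := hcb.trans (Finset.sum_le_sum fun w _ => hF w)
    _ = _ := by
        simp only [Finset.sum_const, Finset.card_univ, Fintype.card_fun, Fintype.card_fin,
          nsmul_eq_mul, Nat.cast_pow]
        ring

theorem achievable_of_rates (g h A B : ℂ) (hAB : ‖A‖ ^ 2 + ‖B‖ ^ 2 < 1) {ρ : Fin 3 → ℝ}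
    (hρ : ∀ d, ρ (stepTarget d).2 = 0 ∨ 0 < ρ (stepTarget d).2 ∧
      ρ (stepTarget d).2 < Real.logb 2 (1 + ‖stepGain g h A B d‖ ^ 2 /
        ∑ j, ‖Function.update (stepCoef g h A B d) (stepRole d) 0 j‖ ^ 2))
    {R : ℝ} (hR0 : 0 ≤ R) (hR : R = 0 ∨ 2 * R < ∑ t, ρ t) : Achievable g h (R, R) := by
  refine ⟨hR0, hR0, fun ε hε => ?_⟩
  have hρ0 : 0 ≤ ∑ t, ρ t := by
    refine Finset.sum_nonneg fun t _ => ?_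
    have : ∃ d, (stepTarget d).2 = t := by
      fin_cases t
      exacts [⟨(0, 0), rfl⟩, ⟨(0, 3), rfl⟩, ⟨(0, 4), rfl⟩]
    obtain ⟨d, rfl⟩ := this
    rcases hρ d with h0 | h0
    exacts [h0.ge, h0.1.le]
  obtain ⟨T, hT⟩ := eventually_badEvent_le g h A B hAB hρ
  have hrate : ∀ᶠ N : ℕ in atTop, ∀ r < 2, ((N + N + r : ℕ) : ℝ) * R ≤ N * ∑ t, ρ t := by
    rcases hR with rfl | hR
    · exact Eventually.of_forall fun N r _ => by rw [mul_zero]; positivity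
    · have hγ : 0 < ∑ t, ρ t - 2 * R := sub_pos.2 hR
      -- For odd block length one channel use is idle. The slack `N * γ` eventually covers its rate
      -- `R`.
      filter_upwards [(tendsto_natCast_atTop_atTop.atTop_mul_const hγ).eventually_ge_atTop R]
        with N hN r hr
      have hr1 : (r : ℝ) ≤ 1 := by exact_mod_cast Nat.lt_succ_iff.1 hr
      push_cast
      nlinarith
  have hmain := (Nat.tendsto_div_const_atTop two_ne_zero).eventually ((hT ε hε).and hrate)
  filter_upwards [hmain] with n hn
  obtain ⟨N, r, hr, hnN, rfl⟩ : ∃ N r, r < 2 ∧ n / 2 = N ∧ n = N + N + r :=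
    ⟨n / 2, n % 2, Nat.mod_lt _ two_pos, rfl, by omega⟩
  rw [hnN] at hn
  have : ∀ t, Nonempty (Fin (bookSize N ρ t)) := fun t =>
    Fin.pos_iff_nonempty.1 (bookSize_pos N ρ t)
  obtain ⟨cb, hcb⟩ := exists_codebook (r := r) g h A B T hn.1
  have hsize : (2 : ℝ) ^ (((N + N + r : ℕ) : ℝ) * R) ≤ ((∏ t, bookSize N ρ t : ℕ) : ℝ) := by
    calc (2 : ℝ) ^ (((N + N + r : ℕ) : ℝ) * R) ≤ 2 ^ (N * ∑ t, ρ t) :=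
          Real.rpow_le_rpow_of_exponent_le one_le_two (hn.2 r hr)
      _ = ∏ t, (2 : ℝ) ^ (N * ρ t) := by
          rw [Finset.mul_sum, Real.rpow_sum_of_pos two_pos]
      _ ≤ _ := by
          push_cast
          exact Finset.prod_le_prod (fun _ _ => by positivity) fun t _ => Nat.le_ceil _
  exact ⟨fun _ => ∏ t, bookSize N ρ t, superpositionCode g h A B T cb r, hsize, hsize,
    powerConstraint_superpositionCode g h A B T cb r, hcb⟩

/-! ### Rates of the decoding steps -/

/-- Signal-to-noise ratio of a common codeword, of power `α`, at the transmitter of the other user,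
where `β` is the power of the private codewords. -/
noncomputable def commonRatio (I α β : ℝ) : ℝ := I * α / (1 + I * β)

/-- Signal-to-noise ratio of a private codeword of power `β` at its receiver. -/
noncomputable def privateRatio (S I β : ℝ) : ℝ := S * β / (1 + I * β)

theorem norm_alamoutiSign (k : Fin 2) : ‖alamoutiSign k‖ = 1 := by
  fin_cases k <;> simp [alamoutiSign]

theorem norm_conj_mul_add_mul_conj (g h : ℂ) :
    ‖starRingEnd ℂ g * g + h * starRingEnd ℂ h‖ = ‖g‖ ^ 2 + ‖h‖ ^ 2 := by
  rw [Complex.conj_mul', Complex.mul_conj', ← Complex.ofReal_pow, ← Complex.ofReal_pow,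
    ← Complex.ofReal_add, Complex.norm_real, Real.norm_of_nonneg (by positivity)]

/-- Both sides have the form `xα/(1 + xβ)`, increasing in `x`, with `x = I` on the left and `x = S +
I` on the right. Thus the transmitters, not the receivers, limit the common rate. -/
theorem commonRatio_le (S I : ℝ) {α β : ℝ} (hS : 0 ≤ S) (hI : 0 ≤ I) (hα : 0 ≤ α) (hβ : 0 ≤ β) :
    commonRatio I α β ≤ (S + I) ^ 2 * α / ((S + I) * ((S + I) * β + 1)) := by
  rcases (add_nonneg hS hI).eq_or_lt with h0 | h0
  · have : I = 0 := by linarith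
    simp only [commonRatio, this, zero_mul, zero_div, add_zero]
    have : S = 0 := by linarith
    simp [this]
  · have e : (S + I) ^ 2 * α / ((S + I) * ((S + I) * β + 1)) = (S + I) * α / ((S + I) * β + 1) := by
      field_simp
    rw [e, commonRatio, div_le_div_iff₀ (by positivity) (by positivity)]
    nlinarith [mul_nonneg hS hα]

/-- The interference is computed as total power minus that of the target. After Alamouti combining,
the private codewords contribute `(S + I)²β` and the noises `S + I`. -/
theorem stepRatio_eq (g h A B : ℂ) (d : Fin 2 × Fin 5) :
    ‖stepGain g h A B d‖ ^ 2 /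
        ∑ j, ‖Function.update (stepCoef g h A B d) (stepRole d) 0 j‖ ^ 2 =
      ![commonRatio (‖h‖ ^ 2) (‖A‖ ^ 2) (‖B‖ ^ 2),
        (‖g‖ ^ 2 + ‖h‖ ^ 2) ^ 2 * ‖A‖ ^ 2 /
          ((‖g‖ ^ 2 + ‖h‖ ^ 2) * ((‖g‖ ^ 2 + ‖h‖ ^ 2) * ‖B‖ ^ 2 + 1)),
        (‖g‖ ^ 2 + ‖h‖ ^ 2) ^ 2 * ‖A‖ ^ 2 /
          ((‖g‖ ^ 2 + ‖h‖ ^ 2) * ((‖g‖ ^ 2 + ‖h‖ ^ 2) * ‖B‖ ^ 2 + 1)),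
        privateRatio (‖g‖ ^ 2) (‖h‖ ^ 2) (‖B‖ ^ 2),
        privateRatio (‖g‖ ^ 2) (‖h‖ ^ 2) (‖B‖ ^ 2)] d.2 := by
  have e := sum_norm_sq_update (stepCoef g h A B d) (stepRole d)
  rw [← sub_eq_iff_eq_add] at e
  rw [← e]
  change ‖stepGain g h A B d‖ ^ 2 / (_ - ‖stepGain g h A B d‖ ^ 2) = _
  obtain ⟨k, i⟩ := d
  have hne : (1 - k) ≠ k := by fin_cases k <;> decide
  have hn2 : ‖starRingEnd ℂ h * h + g * starRingEnd ℂ g‖ = ‖g‖ ^ 2 + ‖h‖ ^ 2 := by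
    rw [norm_conj_mul_add_mul_conj, add_comm]
  rw [stepCoef, sum_norm_sq_coefs]
  fin_cases i <;>
  · simp [stepGain, stepRole, stepTarget, stepCoef, coefs, Fin.sum_univ_three, hne, commonRatio,
      privateRatio, norm_alamoutiSign, norm_conj_mul_add_mul_conj, hn2, mul_pow]
    try ring_nf

/-- Scaling all book rates by some `θ < 1` makes positive rates strictly smaller than capacity and
keeps zero rates zero. -/
theorem achievable_of_lt (g h A B : ℂ) (hAB : ‖A‖ ^ 2 + ‖B‖ ^ 2 < 1) {R : ℝ} (hR0 : 0 ≤ R)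
    (hR : R = 0 ∨ 2 * R < Real.logb 2 (1 + commonRatio (‖h‖ ^ 2) (‖A‖ ^ 2) (‖B‖ ^ 2))
      + 2 * Real.logb 2 (1 + privateRatio (‖g‖ ^ 2) (‖h‖ ^ 2) (‖B‖ ^ 2))) :
    Achievable g h (R, R) := by
  set qc := commonRatio (‖h‖ ^ 2) (‖A‖ ^ 2) (‖B‖ ^ 2) with hqc
  set qp := privateRatio (‖g‖ ^ 2) (‖h‖ ^ 2) (‖B‖ ^ 2) with hqp
  have hqc0 : 0 ≤ qc := by rw [hqc, commonRatio]; positivity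
  have hqp0 : 0 ≤ qp := by rw [hqp, privateRatio]; positivity
  have hc0 : 0 ≤ Real.logb 2 (1 + qc) := Real.logb_nonneg one_lt_two (by linarith)
  have hp0 : 0 ≤ Real.logb 2 (1 + qp) := Real.logb_nonneg one_lt_two (by linarith)
  obtain ⟨θ, hθ0, hθ1, hθ⟩ : ∃ θ : ℝ, 0 < θ ∧ θ < 1 ∧ (R = 0 ∨
      2 * R < θ * (Real.logb 2 (1 + qc) + 2 * Real.logb 2 (1 + qp))) := by
    rcases hR with hR | hR
    · exact ⟨1 / 2, by norm_num, by norm_num, Or.inl hR⟩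
    · set Q := Real.logb 2 (1 + qc) + 2 * Real.logb 2 (1 + qp) with hQ
      have hQ0 : 0 < Q := by linarith
      have h1 : 2 * R / Q < 1 := (div_lt_one hQ0).2 hR
      have h2 : 0 ≤ 2 * R / Q := by positivity
      refine ⟨(2 * R / Q + 1) / 2, by linarith, by linarith, Or.inr ?_⟩
      rw [← div_lt_iff₀ hQ0]
      linarith
  have hscale : ∀ {x y : ℝ}, 0 ≤ x → x ≤ y → θ * x = 0 ∨ 0 < θ * x ∧ θ * x < y := by
    intro x y hx hxy
    rcases hx.eq_or_lt with rfl | hx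
    · exact Or.inl (mul_zero _)
    · exact Or.inr ⟨mul_pos hθ0 hx, by nlinarith⟩
  refine achievable_of_rates g h A B hAB
    (ρ := ![θ * Real.logb 2 (1 + qc), θ * Real.logb 2 (1 + qp), θ * Real.logb 2 (1 + qp)])
    (fun d => ?_) hR0 ?_
  · have hle : Real.logb 2 (1 + qc) ≤ Real.logb 2 (1 + (‖g‖ ^ 2 + ‖h‖ ^ 2) ^ 2 * ‖A‖ ^ 2 /
          ((‖g‖ ^ 2 + ‖h‖ ^ 2) * ((‖g‖ ^ 2 + ‖h‖ ^ 2) * ‖B‖ ^ 2 + 1))) := by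
      refine Real.logb_le_logb_of_le one_lt_two (by linarith) ?_
      have := commonRatio_le (‖g‖ ^ 2) (‖h‖ ^ 2) (α := ‖A‖ ^ 2) (β := ‖B‖ ^ 2) (by positivity)
        (by positivity) (by positivity) (by positivity)
      linarith
    rw [stepRatio_eq]
    obtain ⟨k, i⟩ := d
    fin_cases i
    exacts [hscale hc0 le_rfl, hscale hc0 hle, hscale hc0 hle, hscale hp0 le_rfl,
      hscale hp0 le_rfl]
  · rcases hθ with h0 | h0
    · exact Or.inl h0
    · refine Or.inr (h0.trans_le (le_of_eq ?_))
      simp [Fin.sum_univ_three]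
      ring

/-- Scaling the powers by `η < 1` makes the power bound strict, and subtracting `1 - η` makes the
rate bound strict. The maximum with `0` keeps the rate admissible, and `η → 1` reaches `R` in the
closure. -/
theorem mem_capacityRegion (g h : ℂ) {α β : ℝ} (hα : 0 ≤ α) (hβ : 0 ≤ β) (hαβ : α + β ≤ 1) {R : ℝ}
    (hR : R = 1 / 2 * Real.logb 2 (1 + commonRatio (‖h‖ ^ 2) α β)
      + Real.logb 2 (1 + privateRatio (‖g‖ ^ 2) (‖h‖ ^ 2) β)) :
    (R, R) ∈ capacityRegion g h := by
  let Q : ℝ → ℝ := fun η => 1 / 2 * Real.logb 2 (1 + commonRatio (‖h‖ ^ 2) (η * α) (η * β))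
      + Real.logb 2 (1 + privateRatio (‖g‖ ^ 2) (‖h‖ ^ 2) (η * β))
  have hR0 : 0 ≤ R := by
    have h1 : 0 ≤ commonRatio (‖h‖ ^ 2) α β := by rw [commonRatio]; positivity
    have h2 : 0 ≤ privateRatio (‖g‖ ^ 2) (‖h‖ ^ 2) β := by rw [privateRatio]; positivity
    have h3 := Real.logb_nonneg one_lt_two (le_add_of_nonneg_right h1)
    have h4 := Real.logb_nonneg one_lt_two (le_add_of_nonneg_right h2)
    rw [hR]
    linarith
  have hcont : ContinuousAt (fun η => max 0 (Q η - (1 - η))) 1 := by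
    have hden : 1 + ‖h‖ ^ 2 * (1 * β) ≠ 0 := by positivity
    have h1 : ContinuousAt (fun η => 1 + commonRatio (‖h‖ ^ 2) (η * α) (η * β)) 1 := by
      unfold commonRatio
      exact continuousAt_const.add (ContinuousAt.div (by fun_prop) (by fun_prop) hden)
    have h2 : ContinuousAt (fun η => 1 + privateRatio (‖g‖ ^ 2) (‖h‖ ^ 2) (η * β)) 1 := by
      unfold privateRatio
      exact continuousAt_const.add (ContinuousAt.div (by fun_prop) (by fun_prop) hden)
    have h3 := (h1.log (by unfold commonRatio; positivity)).div_const (Real.log 2)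
    have h4 := (h2.log (by unfold privateRatio; positivity)).div_const (Real.log 2)
    exact continuousAt_const.max (((continuousAt_const.mul h3).add h4).sub (by fun_prop))
  have hval : max 0 (Q 1 - (1 - 1)) = R := by
    simp only [Q, one_mul, sub_self, sub_zero]
    rw [← hR, max_eq_right hR0]
  have hlim : Tendsto (fun η => max 0 (Q η - (1 - η))) (nhdsWithin 1 (Set.Iio 1)) (nhds R) := by
    have := hcont.tendsto.mono_left (nhdsWithin_le_nhds (s := Set.Iio 1))
    rwa [hval] at this
  refine mem_closure_of_tendsto (hlim.prodMk_nhds hlim) ?_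
  filter_upwards [self_mem_nhdsWithin, nhdsWithin_le_nhds (lt_mem_nhds (zero_lt_one' ℝ))]
    with η hη1 hη0
  have hη1' : η < 1 := hη1
  have hA : ‖((√(η * α) : ℝ) : ℂ)‖ ^ 2 = η * α := by
    rw [Complex.norm_real, Real.norm_of_nonneg (Real.sqrt_nonneg _), Real.sq_sqrt (by positivity)]
  have hB : ‖((√(η * β) : ℝ) : ℂ)‖ ^ 2 = η * β := by
    rw [Complex.norm_real, Real.norm_of_nonneg (Real.sqrt_nonneg _), Real.sq_sqrt (by positivity)]
  refine achievable_of_lt g h (√(η * α) : ℝ) (√(η * β) : ℝ) ?_ (le_max_left _ _) ?_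
  · rw [hA, hB]
    nlinarith
  · rw [hA, hB]
    rcases le_total (Q η - (1 - η)) 0 with h0 | h0
    · exact Or.inl (max_eq_left h0)
    · refine Or.inr ?_
      rw [max_eq_right h0]
      simp only [Q]
      linarith

end FeedbackIC

/-! ### The three power splits. -/

theorem theorem2 (gd gc : ℂ) (SNR INR : ℝ) (hSNR : SNR = ‖gd‖ ^ 2) (hINR : INR = ‖gc‖ ^ 2) :
    (SNR ≤ INR →
      ((1 / 2 * Real.logb 2 (1 + INR), 1 / 2 * Real.logb 2 (1 + INR)) : ℝ × ℝ) ∈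
        FeedbackIC.capacityRegion gd gc) ∧
    (INR ≤ SNR → 1 ≤ INR →
      ((Real.logb 2 (1 + SNR / (2 * INR)) + 1 / 2 * Real.logb 2 (1 + INR) - 1 / 2,
        Real.logb 2 (1 + SNR / (2 * INR)) + 1 / 2 * Real.logb 2 (1 + INR) - 1 / 2) : ℝ × ℝ) ∈
        FeedbackIC.capacityRegion gd gc) ∧
    (INR ≤ SNR → INR ≤ 1 →
      ((Real.logb 2 (1 + SNR / (INR + 1)), Real.logb 2 (1 + SNR / (INR + 1))) : ℝ × ℝ) ∈
        FeedbackIC.capacityRegion gd gc) := by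
  refine ⟨fun _ => ?_, fun _ hI => ?_, fun _ _ => ?_⟩
  -- All power goes to the common codewords.
  · refine FeedbackIC.mem_capacityRegion gd gc zero_le_one le_rfl (by norm_num) ?_
    simp [FeedbackIC.commonRatio, FeedbackIC.privateRatio, ← hINR]
  · have hI0 : 0 < INR := by linarith
    -- Private codewords arrive at the unintended receiver at noise level. The doubled noise
    -- accounts for the loss of `1/2`.
    refine FeedbackIC.mem_capacityRegion gd gc (α := 1 - 1 / INR) (β := 1 / INR)
      (sub_nonneg.2 ((div_le_one hI0).2 hI)) (by positivity) (by linarith) ?_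
    rw [FeedbackIC.commonRatio, FeedbackIC.privateRatio, ← hINR, ← hSNR]
    have e1 : 1 + INR * (1 - 1 / INR) / (1 + INR * (1 / INR)) = (1 + INR) / 2 := by
      field_simp
      ring
    have e2 : SNR * (1 / INR) / (1 + INR * (1 / INR)) = SNR / (2 * INR) := by
      field_simp
      norm_num
    rw [e1, e2, Real.logb_div (by positivity) two_ne_zero, Real.logb_self_eq_one one_lt_two]
    ring
  -- All power is private: interference is treated as noise and nothing is relayed.
  · refine FeedbackIC.mem_capacityRegion gd gc le_rfl zero_le_one (by norm_num) ?_
    simp [FeedbackIC.commonRatio, FeedbackIC.privateRatio, ← hINR, ← hSNR, add_comm]
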